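/- Let $X$ be a compact metric space, $T:X\to X$ a local homeomorphism and $\varphi\in C(X;\mathbf R)$. Let $$G=G(X,T)=\{(x,m-n,y)\in X\times\mathbf Z\times X:\ m,n\ge 0,\ T^mx=T^ny\}$$ be the associated étale groupoid, with $r(x,k,y)=x$, $s(x,k,y)=y$, product $(x,k,y)(y,l,z)=(x,k+l,z)$, inverse $(x,k,y)^{-1}=(y,-k,x)$, unit space $X$ (via $x\mapsto(x,0,x)$), and the topology generated by the sets $\{(x,m-n,y): x\in U,\ y\in V,\ T^mx=T^ny\}$ with $U,V\subseteq X$ open and $m,n\ge 0$. Let $C^*(G)$ be its full C*-algebra, the completion of the convolution $*$-algebra $C_c(G)$ in the supremum of the norms of its $*$-representations (bounded by the $I$-norm) on Hilbert spaces. Let $$c_\varphi(x,m-n,y)=\sum_{i=0}^{m-1}\varphi(T^ix)-\sum_{j=0}^{n-1}\varphi(T^jy)\qquad (T^mx=T^ny),$$ a continuous one-cocycle on $G$, and let $\alpha$ be the action of $\mathbf R$ on $C^*(G)$ with $\alpha_t(f)(\gamma)=e^{itc_\varphi(\gamma)}f(\gamma)$ for $f\in C_c(G)$. Let $\beta\in\mathbf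 R$. A state $\omega$ of $C^*(G)$ is a KMS state for $\alpha$ at inverse temperature $\beta$ if $\omega(b\,\alpha_{i\beta}(a))=\omega(ab)$ for all $a,b\in C^*(G)$ with $a$ entire for $\alpha$ and, in the case $\beta=0$, if moreover $\omega$ is $\alpha$-invariant (for $\beta\neq0$ the invariance is automatic). Suppose that the subgroupoid $c_\varphi^{-1}(0)$ is principal, that is, that $(r,s)$ is injective on it. Then for every KMS state $\omega$ for $\alpha$ at inverse temperature $\beta$ there is a Borel probability measure $\mu$ on $X$ such that $\omega=\omega_\mu$, that is, $$\omega(f)=\int_X f(x,0,x)\,d\mu(x)\qquad\text{for all } f\in C_c(G),$$ and such that $\mu$ is quasi-invariant with Radon–Nikodym derivative $$\frac{dr^*\mu}{ds^*\mu}=e^{-\beta c_\varphi}.$$ Here $r^*\mu$ and $s^*\mu$ are the measures on $G$ with $r^*\mu(E)=\int_X \#(E\cap r^{-1}(x))\,d\mu(x)$ and $s^*\mu(E)=\int_X \#(E\cap s^{-1}(x))\,d\mu(x)$, and quasi-invariant means that they are mutually absolutely continuous. -/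

import Mathlib

noncomputable section

open Set Filter Topology MeasureTheory
open scoped CompactlySupported ENNReal ComplexOrder ContinuousMap

universe u

/-- The Deaconu–Renault groupoid `G(X, T) = {(x, m - n, y) : T^m x = T^n y}`. -/
def DRGroupoid {X : Type u} (T : X → X) : Type u :=
  {g : X × ℤ × X // ∃ m n : ℕ, g.2.1 = (m : ℤ) - n ∧ T^[m] g.1 = T^[n] g.2.2}

namespace DRGroupoid

variable {X : Type u} {T : X → X}

/-- The range map `r (x, k, y) = x`; the unit space is identified with `X`. -/
def r (g : DRGroupoid T) : X := g.1.1

/-- The degree `k` of `(x, k, y)`. -/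
def deg (g : DRGroupoid T) : ℤ := g.1.2.1

/-- The source map `s (x, k, y) = y`. -/
def s (g : DRGroupoid T) : X := g.1.2.2

theorem exists_rep (g : DRGroupoid T) :
    ∃ m n : ℕ, g.deg = (m : ℤ) - n ∧ T^[m] g.r = T^[n] g.s := g.2

theorem ext' {g h : DRGroupoid T} (h1 : g.r = h.r) (h2 : g.deg = h.deg) (h3 : g.s = h.s) :
    g = h := Subtype.ext (Prod.ext h1 (Prod.ext h2 h3))

/-- The unit `(x, 0, x)` at `x`. -/
def unit (T : X → X) (x : X) : DRGroupoid T := ⟨(x, 0, x), 0, 0, by simp, rfl⟩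

/-- The inverse `(x, k, y)⁻¹ = (y, -k, x)`. -/
def inv (g : DRGroupoid T) : DRGroupoid T :=
  ⟨(g.s, -g.deg, g.r), by
    obtain ⟨m, n, h1, h2⟩ := g.exists_rep
    exact ⟨n, m, by simp [h1], h2.symm⟩⟩

/-- The product `(x, k, y) (y, l, z) = (x, k + l, z)` of a composable pair. -/
def comp (g h : DRGroupoid T) (hgh : g.s = h.r) : DRGroupoid T :=
  ⟨(g.r, g.deg + h.deg, h.s), by
    obtain ⟨m, n, h1, h2⟩ := g.exists_rep
    obtain ⟨p, q, h3, h4⟩ := h.exists_rep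
    refine ⟨p + m, n + q, by simp only [h1, h3]; push_cast; ring, ?_⟩
    simp only
    rw [Function.iterate_add_apply, h2, hgh, ← Function.iterate_add_apply, add_comm p n,
      Function.iterate_add_apply, h4, ← Function.iterate_add_apply]⟩

@[simp] theorem r_inv (g : DRGroupoid T) : g.inv.r = g.s := rfl
@[simp] theorem s_inv (g : DRGroupoid T) : g.inv.s = g.r := rfl
@[simp] theorem deg_inv (g : DRGroupoid T) : g.inv.deg = -g.deg := rfl
@[simp] theorem r_comp (g h : DRGroupoid T) (e : g.s = h.r) : (g.comp h e).r = g.r := rfl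
@[simp] theorem s_comp (g h : DRGroupoid T) (e : g.s = h.r) : (g.comp h e).s = h.s := rfl
@[simp] theorem deg_comp (g h : DRGroupoid T) (e : g.s = h.r) :
    (g.comp h e).deg = g.deg + h.deg := rfl
@[simp] theorem r_unit (x : X) : (unit T x).r = x := rfl
@[simp] theorem s_unit (x : X) : (unit T x).s = x := rfl
@[simp] theorem deg_unit (x : X) : (unit T x).deg = 0 := rfl

theorem cocycle_aux (φ : X → ℝ) {m n m' n' : ℕ} {x y : X} (h : T^[m] x = T^[n] y)
    (h' : T^[m'] x = T^[n'] y) (hk : (m : ℤ) - n = m' - n') :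
    birkhoffSum T φ m x - birkhoffSum T φ n y = birkhoffSum T φ m' x - birkhoffSum T φ n' y := by
  wlog hm : m ≤ m' generalizing m n m' n'
  · exact (this h' h hk.symm (by omega)).symm
  obtain ⟨j, rfl⟩ := Nat.exists_eq_add_of_le hm
  obtain rfl : n' = n + j := by omega
  rw [birkhoffSum_add, birkhoffSum_add, h]
  ring

/-! ### The topology -/

/-- The basic set `{(x, m - n, y) : x ∈ U, y ∈ V, T^m x = T^n y}`. -/
def basicSet (T : X → X) (U : Set X) (m n : ℕ) (V : Set X) : Set (DRGroupoid T) :=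
  {g | g.r ∈ U ∧ g.s ∈ V ∧ g.deg = (m : ℤ) - n ∧ T^[m] g.r = T^[n] g.s}

variable [TopologicalSpace X]

/-- The étale topology of `G(X, T)`: it is generated by the basic sets with `U`, `V` open. -/
instance : TopologicalSpace (DRGroupoid T) :=
  TopologicalSpace.generateFrom
    {S | ∃ (U V : Set X) (m n : ℕ), IsOpen U ∧ IsOpen V ∧ S = basicSet T U m n V}

theorem isOpen_basicSet {U V : Set X} (hU : IsOpen U) (hV : IsOpen V) (m n : ℕ) :
    IsOpen (basicSet T U m n V) :=
  TopologicalSpace.isOpen_generateFrom_of_mem ⟨U, V, m, n, hU, hV, rfl⟩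

theorem continuous_r : Continuous (r : DRGroupoid T → X) := by
  refine continuous_def.2 fun U hU => ?_
  have : r ⁻¹' U = ⋃ (m : ℕ) (n : ℕ), basicSet T U m n univ := by
    ext g
    obtain ⟨m, n, h1, h2⟩ := g.exists_rep
    simp only [mem_preimage, mem_iUnion, basicSet, mem_ofPred_eq, mem_univ, true_and]
    exact ⟨fun h => ⟨m, n, h, h1, h2⟩, fun ⟨_, _, h, _⟩ => h⟩
  rw [this]
  exact isOpen_iUnion fun m => isOpen_iUnion fun n => isOpen_basicSet hU isOpen_univ m n

theorem continuous_inv : Continuous (inv : DRGroupoid T → DRGroupoid T) := by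
  refine continuous_generateFrom_iff.2 ?_
  rintro _ ⟨U, V, m, n, hU, hV, rfl⟩
  convert isOpen_basicSet (T := T) hV hU n m using 1
  ext g
  simp only [basicSet, mem_preimage, mem_ofPred_eq, r_inv, s_inv, deg_inv]
  constructor
  · rintro ⟨a, b, c, d⟩; exact ⟨b, a, by omega, d.symm⟩
  · rintro ⟨a, b, c, d⟩; exact ⟨b, a, by omega, d.symm⟩

theorem continuous_s : Continuous (s : DRGroupoid T → X) :=
  (continuous_r (T := T)).comp continuous_inv

theorem continuous_deg : Continuous (deg : DRGroupoid T → ℤ) := by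
  refine continuous_discrete_rng.2 fun k => ?_
  have : deg ⁻¹' {k} = ⋃ (m : ℕ) (n : ℕ) (_ : k = (m : ℤ) - n), basicSet T univ m n univ := by
    ext g
    obtain ⟨m, n, h1, h2⟩ := g.exists_rep
    simp only [mem_preimage, mem_iUnion, basicSet, mem_ofPred_eq, mem_univ, true_and,
      mem_singleton_iff]
    constructor
    · rintro rfl; exact ⟨m, n, h1, h1, h2⟩
    · rintro ⟨_, _, h, h', _⟩; exact h'.trans h.symm
  rw [this]
  exact isOpen_iUnion fun m => isOpen_iUnion fun n => isOpen_iUnion fun _ =>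
    isOpen_basicSet isOpen_univ isOpen_univ m n

instance [T2Space X] : T2Space (DRGroupoid T) :=
  T2Space.of_injective_continuous (f := fun g : DRGroupoid T => (g.r, g.deg, g.s))
    (fun g h e => by
      simp only [Prod.mk.injEq] at e
      exact ext' e.1 e.2.1 e.2.2)
    (continuous_r.prodMk (continuous_deg.prodMk continuous_s))

/-- Every neighbourhood of a point contains a basic set around it. -/
theorem isTopologicalBasis :
    TopologicalSpace.IsTopologicalBasis
      {S | ∃ (U V : Set X) (m n : ℕ), IsOpen U ∧ IsOpen V ∧ S = basicSet T U m n V} where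
  exists_subset_inter := by
    rintro _ ⟨U, V, m, n, hU, hV, rfl⟩ _ ⟨U', V', m', n', hU', hV', rfl⟩ g ⟨hg, hg'⟩
    have key : ∀ (m n m' n' : ℕ), m ≤ m' → (m : ℤ) - n = m' - n' → ∀ x y : X,
        T^[m] x = T^[n] y → T^[m'] x = T^[n'] y := by
      intro m n m' n' hm hk x y h
      obtain ⟨j, rfl⟩ := Nat.exists_eq_add_of_le' hm
      have : n' = j + n := by omega
      subst this
      rw [Function.iterate_add_apply, h, ← Function.iterate_add_apply]
    have hk : (m : ℤ) - n = m' - n' := hg.2.2.1.symm.trans hg'.2.2.1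
    rcases le_total m m' with hm | hm
    · refine ⟨_, ⟨U ∩ U', V ∩ V', m, n, hU.inter hU', hV.inter hV', rfl⟩,
        ⟨⟨hg.1, hg'.1⟩, ⟨hg.2.1, hg'.2.1⟩, hg.2.2⟩, ?_⟩
      rintro h ⟨h1, h2, h3, h4⟩
      exact ⟨⟨h1.1, h2.1, h3, h4⟩, ⟨h1.2, h2.2, h3.trans hk, key _ _ _ _ hm hk _ _ h4⟩⟩
    · refine ⟨_, ⟨U ∩ U', V ∩ V', m', n', hU.inter hU', hV.inter hV', rfl⟩,
        ⟨⟨hg.1, hg'.1⟩, ⟨hg.2.1, hg'.2.1⟩, hg'.2.2⟩, ?_⟩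
      rintro h ⟨h1, h2, h3, h4⟩
      exact ⟨⟨h1.1, h2.1, h3.trans hk.symm, key _ _ _ _ hm hk.symm _ _ h4⟩,
        ⟨h1.2, h2.2, h3, h4⟩⟩
  sUnion_eq := by
    refine eq_univ_of_forall fun g => ?_
    obtain ⟨m, n, h1, h2⟩ := g.exists_rep
    exact ⟨_, ⟨univ, univ, m, n, isOpen_univ, isOpen_univ, rfl⟩, trivial, trivial, h1, h2⟩
  eq_generateFrom := rfl

theorem iterate_isLocalHomeomorph (hT : IsLocalHomeomorph T) (n : ℕ) :
    IsLocalHomeomorph (T^[n]) := by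
  induction n with
  | zero => exact (Homeomorph.refl X).isLocalHomeomorph
  | succ k ih => rw [Function.iterate_succ]; exact ih.comp hT

/-- A local homeomorphism is injective on a neighbourhood of each point. -/
theorem exists_injOn (hT : IsLocalHomeomorph T) (n : ℕ) (x : X) :
    ∃ O : Set X, IsOpen O ∧ x ∈ O ∧ InjOn (T^[n]) O := by
  obtain ⟨e, hx, he⟩ := iterate_isLocalHomeomorph hT n x
  exact ⟨e.source, e.open_source, hx, he ▸ e.injOn⟩

theorem isOpenMap_r (hT : IsLocalHomeomorph T) : IsOpenMap (r : DRGroupoid T → X) := by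
  refine isTopologicalBasis.isOpenMap_iff.2 ?_
  rintro _ ⟨U, V, m, n, hU, hV, rfl⟩
  have : r '' basicSet T U m n V = U ∩ T^[m] ⁻¹' (T^[n] '' V) := by
    ext x
    constructor
    · rintro ⟨g, ⟨h1, h2, _, h4⟩, rfl⟩
      exact ⟨h1, g.s, h2, h4.symm⟩
    · rintro ⟨h1, y, hy, h2⟩
      exact ⟨⟨(x, (m : ℤ) - n, y), m, n, rfl, h2.symm⟩, ⟨h1, hy, rfl, h2.symm⟩, rfl⟩
  rw [this]
  exact hU.inter (((iterate_isLocalHomeomorph hT n).isOpenMap _ hV).preimage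
    (iterate_isLocalHomeomorph hT m).continuous)

/-- The range map of `G(X, T)` is a local homeomorphism: the groupoid is étale. -/
theorem isLocalHomeomorph_r (hT : IsLocalHomeomorph T) :
    IsLocalHomeomorph (r : DRGroupoid T → X) := by
  refine isLocalHomeomorph_iff_isOpenEmbedding_restrict.2 fun g => ?_
  obtain ⟨m, n, h1, h2⟩ := g.exists_rep
  obtain ⟨O, hO, hgO, hinj⟩ := exists_injOn hT n g.s
  have ho : IsOpen (basicSet T univ m n O) := isOpen_basicSet isOpen_univ hO m n
  refine ⟨basicSet T univ m n O, ho.mem_nhds ⟨trivial, hgO, h1, h2⟩, ?_⟩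
  refine IsOpenEmbedding.of_continuous_injective_isOpenMap
    (continuous_r.comp continuous_subtype_val) ?_ ((isOpenMap_r hT).domRestrict ho)
  rintro ⟨a, ha0, ha, ha1, ha2⟩ ⟨b, hb0, hb, hb1, hb2⟩ hab
  replace hab : a.r = b.r := hab
  refine Subtype.ext (ext' hab (ha1.trans hb1.symm) (hinj ha hb ?_))
  rw [← ha2, ← hb2, hab]

theorem continuous_comp (hT : IsLocalHomeomorph T) :
    Continuous (fun p : {p : DRGroupoid T × DRGroupoid T // p.1.s = p.2.r} =>
      p.1.1.comp p.1.2 p.2) := by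
  refine continuous_generateFrom_iff.2 ?_
  rintro _ ⟨U, V, m, n, hU, hV, rfl⟩
  refine isOpen_iff_mem_nhds.2 ?_
  rintro ⟨⟨a, b⟩, hab⟩ ⟨h1, h2, h3, h4⟩
  simp only [r_comp, s_comp, deg_comp] at h1 h2 h3 h4
  obtain ⟨p, q, ha1, ha2⟩ := a.exists_rep
  obtain ⟨p', q', hb1, hb2⟩ := b.exists_rep
  obtain ⟨O, hO, haO, hinj⟩ := exists_injOn hT (p' + p - m) (T^[m] a.r)
  have hca := (iterate_isLocalHomeomorph hT m).continuous
  have hcb := (iterate_isLocalHomeomorph hT n).continuous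
  have hA := isOpen_basicSet (T := T) (hU.inter (hO.preimage hca)) isOpen_univ p q
  have hB := isOpen_basicSet (T := T) isOpen_univ (hV.inter (hO.preimage hcb)) p' q'
  have hbO : T^[n] b.s ∈ O := h4 ▸ haO
  have hmem : (⟨(a, b), hab⟩ : {p : DRGroupoid T × DRGroupoid T // p.1.s = p.2.r}) ∈
      Subtype.val ⁻¹' (basicSet T (U ∩ T^[m] ⁻¹' O) p q univ ×ˢ
        basicSet T univ p' q' (V ∩ T^[n] ⁻¹' O)) :=
    ⟨⟨⟨h1, haO⟩, trivial, ha1, ha2⟩, ⟨trivial, ⟨h2, hbO⟩, hb1, hb2⟩⟩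
  refine mem_of_superset
    (((hA.prod hB).preimage continuous_subtype_val).mem_nhds hmem) ?_
  rintro ⟨⟨c, d⟩, hcd⟩ ⟨⟨⟨hc1, hc2⟩, -, hc3, hc4⟩, ⟨-, ⟨hd1, hd2⟩, hd3, hd4⟩⟩
  simp only at hcd hc1 hc2 hc3 hc4 hd1 hd2 hd3 hd4
  have hN : (p : ℤ) - q + (p' - q') = m - n := by rw [← ha1, ← hb1, h3]
  refine ⟨hc1, hd1, by simp only [deg_comp]; omega, ?_⟩
  simp only [r_comp, s_comp]
  have hM : T^[p' + p] c.r = T^[q + q'] d.s := by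
    rw [Function.iterate_add_apply, hc4, hcd, ← Function.iterate_add_apply, add_comm p' q,
      Function.iterate_add_apply, hd4, ← Function.iterate_add_apply]
  rcases le_total m (p' + p) with hm | hm
  · refine hinj hc2 hd2 ?_
    rw [← Function.iterate_add_apply, ← Function.iterate_add_apply]
    have e1 : p' + p - m + m = p' + p := by omega
    have e2 : p' + p - m + n = q + q' := by omega
    rw [e1, e2, hM]
  · have e1 : m = (m - (p' + p)) + (p' + p) := by omega
    have e2 : n = (m - (p' + p)) + (q + q') := by omega
    rw [e1, Function.iterate_add_apply, hM, ← Function.iterate_add_apply, ← e2]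

/-- Continuous local sections of the range map through a given point. -/
theorem exists_section (hT : IsLocalHomeomorph T) (a : DRGroupoid T) {O : Set (DRGroupoid T)}
    (hO : IsOpen O) (ha : a ∈ O) :
    ∃ (U : Set (DRGroupoid T)) (σ : X → DRGroupoid T), IsOpen U ∧ a ∈ U ∧ U ⊆ O ∧ InjOn r U ∧
      IsOpen (r '' U) ∧ ContinuousOn σ (r '' U) ∧ ∀ x ∈ r '' U, σ x ∈ U ∧ (σ x).r = x := by
  obtain ⟨e, hx, he⟩ := isLocalHomeomorph_r hT a
  refine ⟨e.source ∩ O, e.symm, e.open_source.inter hO, ⟨hx, ha⟩, inter_subset_right, ?_,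
    isOpenMap_r hT _ (e.open_source.inter hO), ?_, ?_⟩
  · rw [he]; exact e.injOn.mono inter_subset_left
  · refine e.continuousOn_symm.mono ?_
    rintro _ ⟨b, ⟨hb, -⟩, rfl⟩
    rw [he]; exact e.map_source hb
  · rintro _ ⟨b, ⟨hb, hb'⟩, rfl⟩
    have : e.symm (r b) = b := by rw [he]; exact e.left_inv hb
    rw [this]; exact ⟨⟨hb, hb'⟩, rfl⟩

/-! ### The convolution `*`-algebra `C_c(G)` -/

/-- The element `α⁻¹ γ`, where `r(α) = r(γ)`. -/
def ldiv (a γ : DRGroupoid T) (h : a.r = γ.r) : DRGroupoid T :=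
  a.inv.comp γ ((s_inv a).trans h)

/-- The convolution `(f * g)(γ) = ∑_{r(α) = r(γ)} f(α) g(α⁻¹ γ)`; only finitely many terms are
nonzero when `f` has compact support. -/
def convFun (f g : DRGroupoid T → ℂ) (γ : DRGroupoid T) : ℂ :=
  ∑ᶠ a : {a : DRGroupoid T // a.r = γ.r}, f a * g (a.1.ldiv γ a.2)

theorem finite_fiber [T2Space X] (hT : IsLocalHomeomorph T) {K : Set (DRGroupoid T)}
    (hK : IsCompact K) (x : X) : (K ∩ r ⁻¹' {x}).Finite := by
  have hc : IsCompact (K ∩ r ⁻¹' {x}) := hK.inter_right (isClosed_singleton.preimage continuous_r)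
  refine hc.finite (isDiscrete_iff_forall_mem_exists_isOpen.2 fun a ha => ?_)
  obtain ⟨U, σ, hU, haU, -, hinj, -⟩ := exists_section hT a isOpen_univ trivial
  refine ⟨U, hU, ?_⟩
  ext b
  constructor
  · rintro ⟨hb, hb', hbx⟩
    exact hinj hb haU (hbx.trans ha.2.symm)
  · rintro rfl; exact ⟨haU, ha⟩

theorem continuous_convFun [T2Space X] (hT : IsLocalHomeomorph T) (f g : C_c(DRGroupoid T, ℂ)) :
    Continuous (convFun (f : DRGroupoid T → ℂ) g) := by
  classical
  refine continuous_iff_continuousAt.2 fun γ₀ => ?_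
  set K := tsupport f with hKdef
  have hK : IsCompact K := f.hasCompactSupport
  have hF := finite_fiber hT hK γ₀.r
  set F := K ∩ r ⁻¹' {γ₀.r} with hFdef
  have : Fintype F := hF.fintype
  obtain ⟨O, hO, hdisj⟩ := hF.t2_separation
  choose U σ hU haU hUO hinj hrU hσ hσU using fun a : F =>
    exists_section hT a.1 (hO a.1).2 (hO a.1).1
  have hUdisj : ∀ a b : F, ∀ c, c ∈ U a → c ∈ U b → a = b := by
    intro a b c hca hcb
    by_contra hne
    exact disjoint_left.1 (hdisj a.2 b.2 (fun h => hne (Subtype.ext h))) (hUO a hca) (hUO b hcb)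
  have hK' : IsClosed (r '' (K \ ⋃ a, U a)) :=
    ((hK.diff (isOpen_iUnion hU)).image continuous_r).isClosed
  set W : Set X := (⋂ a, r '' U a) ∩ (r '' (K \ ⋃ a, U a))ᶜ with hWdef
  have hW : IsOpen W := (isOpen_iInter_of_finite hrU).inter hK'.isOpen_compl
  have hW0 : γ₀.r ∈ W := by
    refine ⟨mem_iInter.2 fun a => ⟨a, haU a, a.2.2⟩, ?_⟩
    rintro ⟨b, ⟨hbK, hb⟩, hbr⟩
    exact hb (mem_iUnion.2 ⟨⟨b, hbK, hbr⟩, haU _⟩)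
  set N : Set (DRGroupoid T) := r ⁻¹' W with hNdef
  have hN : IsOpen N := hW.preimage continuous_r
  have hmem : ∀ (γ : N) (a : F), γ.1.r ∈ r '' U a := fun γ a => mem_iInter.1 γ.2.1 a
  have heq : ∀ γ : N, convFun (f : DRGroupoid T → ℂ) g γ =
      ∑ a : F, f (σ a γ.1.r) *
        g ((σ a γ.1.r).ldiv γ (hσU a _ (hmem γ a)).2) := by
    intro γ
    let j : F → {a : DRGroupoid T // a.r = γ.1.r} := fun a =>
      ⟨σ a γ.1.r, (hσU a _ (hmem γ a)).2⟩
    have hj : Function.Injective j := by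
      intro a b hab
      have h1 := (hσU a _ (hmem γ a)).1
      have h2 := (hσU b _ (hmem γ b)).1
      have h3 : σ a γ.1.r = σ b γ.1.r := congrArg Subtype.val hab
      exact hUdisj a b _ h1 (h3 ▸ h2)
    unfold convFun
    rw [← finsum_eq_sum_of_fintype, ← finsum_mem_range
      (f := fun a : {a : DRGroupoid T // a.r = γ.1.r} => f a * g (a.1.ldiv γ a.2)) hj]
    rw [← finsum_mem_univ]
    refine finsum_mem_inter_support_eq' _ _ _ fun a ha => ⟨fun _ => ?_, fun _ => trivial⟩
    have hfa : f a.1 ≠ 0 := left_ne_zero_of_mul ha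
    have haK : a.1 ∈ K := subset_tsupport _ hfa
    have haU' : a.1 ∈ ⋃ a, U a := by
      by_contra hcon
      exact γ.2.2 ⟨a.1, ⟨haK, hcon⟩, a.2⟩
    obtain ⟨b, hb⟩ := mem_iUnion.1 haU'
    have hs := hσU b _ (hmem γ b)
    exact ⟨b, Subtype.ext (hinj b hs.1 hb (hs.2.trans a.2.symm))⟩
  have hcN : Continuous (fun γ : N => convFun (f : DRGroupoid T → ℂ) g γ) := by
    rw [funext heq]
    refine continuous_finsetSum _ fun a _ => ?_
    have h1 : Continuous fun γ : N => σ a γ.1.r :=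
      (hσ a).comp_continuous (continuous_r.comp continuous_subtype_val) fun γ => hmem γ a
    refine ((map_continuous f).comp h1).mul ((map_continuous g).comp ?_)
    exact (continuous_comp hT).comp (Continuous.subtype_mk
      ((continuous_inv.comp h1).prodMk continuous_subtype_val)
      (fun γ => (hσU a _ (hmem γ a)).2))
  exact (continuousOn_iff_continuous_domRestrict.2 hcN).continuousAt (hN.mem_nhds hW0)

theorem hasCompactSupport_convFun [T2Space X] (hT : IsLocalHomeomorph T)
    (f g : C_c(DRGroupoid T, ℂ)) : HasCompactSupport (convFun (f : DRGroupoid T → ℂ) g) := by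
  set P := {p : DRGroupoid T × DRGroupoid T // p.1.s = p.2.r}
  have hcl : IsClosed {p : DRGroupoid T × DRGroupoid T | p.1.s = p.2.r} :=
    isClosed_eq (continuous_s.comp continuous_fst) (continuous_r.comp continuous_snd)
  have hemb : IsClosedEmbedding (Subtype.val : P → DRGroupoid T × DRGroupoid T) :=
    hcl.isClosedEmbedding_subtypeVal
  have hK := hemb.isCompact_preimage (f.hasCompactSupport.prod g.hasCompactSupport)
  refine HasCompactSupport.intro (hK.image (continuous_comp hT)) fun γ hγ => ?_
  unfold convFun
  refine finsum_eq_zero_of_forall_eq_zero fun a => ?_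
  by_contra hne
  refine hγ ⟨⟨(a.1, a.1.ldiv γ a.2), rfl⟩, ⟨subset_tsupport _ (left_ne_zero_of_mul hne),
    subset_tsupport _ (right_ne_zero_of_mul hne)⟩, ?_⟩
  exact ext' a.2 (add_neg_cancel_left a.1.deg γ.deg) rfl

/-- The convolution product on `C_c(G)`. -/
def conv [T2Space X] (hT : IsLocalHomeomorph T) (f g : C_c(DRGroupoid T, ℂ)) :
    C_c(DRGroupoid T, ℂ) :=
  ⟨⟨convFun f g, continuous_convFun hT f g⟩, hasCompactSupport_convFun hT f g⟩

/-- The involution `f^*(γ) = conj f(γ⁻¹)` on `C_c(G)`. -/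
def adj (f : C_c(DRGroupoid T, ℂ)) : C_c(DRGroupoid T, ℂ) :=
  ⟨⟨fun γ => star (f γ.inv), ((map_continuous f).comp continuous_inv).star⟩, by
    have h := f.hasCompactSupport.comp_homeomorph
      (⟨⟨inv, inv, fun g => ext' rfl (by simp) rfl, fun g => ext' rfl (by simp) rfl⟩,
        continuous_inv, continuous_inv⟩ : DRGroupoid T ≃ₜ DRGroupoid T)
    exact h.comp_left (g := star) (star_zero ℂ)⟩

/-- The `I`-norm
`‖f‖_I = max (sup_x ∑_{r(γ) = x} |f(γ)|) (sup_x ∑_{s(γ) = x} |f(γ)|)`. Both suprema are finite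
for `f ∈ C_c(G)`, since a compact set meets the fibres of `r` and `s` in a bounded number of
points, see `bddAbove_normI_r` and `bddAbove_normI_s`. -/
def normI (f : C_c(DRGroupoid T, ℂ)) : ℝ :=
  max (⨆ x : X, ∑ᶠ γ : {γ : DRGroupoid T // γ.r = x}, ‖f γ‖)
    (⨆ x : X, ∑ᶠ γ : {γ : DRGroupoid T // γ.s = x}, ‖f γ‖)

theorem bddAbove_normI_r [T2Space X] (hT : IsLocalHomeomorph T) (f : C_c(DRGroupoid T, ℂ)) :
    BddAbove (range fun x : X => ∑ᶠ γ : {γ : DRGroupoid T // γ.r = x}, ‖f γ‖) := by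
  classical
  obtain ⟨M, hM⟩ := (map_continuous f).bounded_above_of_compact_support f.hasCompactSupport
  choose U σ hU haU _ hinj _ _ _ using fun a : DRGroupoid T =>
    exists_section hT a isOpen_univ trivial
  obtain ⟨I, hI⟩ := f.hasCompactSupport.isCompact.elim_finite_subcover U hU
    fun a _ => mem_iUnion.2 ⟨a, haU a⟩
  refine ⟨I.card * M, ?_⟩
  rintro _ ⟨x, rfl⟩
  have hcov : ∀ γ : DRGroupoid T, f γ ≠ 0 → ∃ i ∈ I, γ ∈ U i := fun γ hγ => by
    simpa using hI (subset_tsupport _ hγ)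
  have hfin : (Function.support fun γ : {γ : DRGroupoid T // γ.r = x} => ‖f γ‖).Finite := by
    refine ((finite_fiber hT f.hasCompactSupport x).preimage
      Subtype.val_injective.injOn).subset fun γ hγ => ⟨subset_tsupport _ ?_, γ.2⟩
    exact norm_ne_zero_iff.1 hγ
  simp only
  rw [finsum_eq_sum _ hfin]
  have hcard : hfin.toFinset.card ≤ I.card := by
    have : Nonempty (DRGroupoid T) := ⟨unit T x⟩
    choose! j hj using hcov
    refine Finset.card_le_card_of_injOn (fun γ => j γ.1) (fun γ hγ => ?_) fun γ hγ γ' hγ' h => ?_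
    · exact (hj _ (norm_ne_zero_iff.1 (hfin.mem_toFinset.1 hγ))).1
    · have h1 := (hj _ (norm_ne_zero_iff.1 (hfin.mem_toFinset.1 hγ))).2
      have h2 := (hj _ (norm_ne_zero_iff.1 (hfin.mem_toFinset.1 hγ'))).2
      simp only at h
      rw [← h] at h2
      exact Subtype.ext (hinj _ h1 h2 (γ.2.trans γ'.2.symm))
  have hM0 : 0 ≤ M := (norm_nonneg _).trans (hM (unit T x))
  calc _ ≤ hfin.toFinset.card • M := Finset.sum_le_card_nsmul _ _ _ fun γ _ => hM γ.1
    _ ≤ _ := by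
      rw [nsmul_eq_mul]
      exact mul_le_mul_of_nonneg_right (by exact_mod_cast hcard) hM0

theorem bddAbove_normI_s [T2Space X] (hT : IsLocalHomeomorph T) (f : C_c(DRGroupoid T, ℂ)) :
    BddAbove (range fun x : X => ∑ᶠ γ : {γ : DRGroupoid T // γ.s = x}, ‖f γ‖) := by
  convert bddAbove_normI_r hT (adj f) using 3 with x
  have hinv : ∀ g : DRGroupoid T, g.inv.inv = g := fun g => ext' rfl (neg_neg _) rfl
  refine finsum_eq_of_bijective
    (fun γ : {γ : DRGroupoid T // γ.s = x} => (⟨γ.1.inv, γ.2⟩ : {γ : DRGroupoid T // γ.r = x}))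
    ⟨fun a b h => ?_, fun b => ⟨⟨b.1.inv, b.2⟩, Subtype.ext (hinv b.1)⟩⟩ fun γ => ?_
  · have h' : a.1.inv = b.1.inv := congrArg Subtype.val h
    exact Subtype.ext (by rw [← hinv a.1, h', hinv])
  · change ‖f γ.1‖ = ‖star (f γ.1.inv.inv)‖
    rw [hinv, norm_star]

/-! ### The cocycle -/

/-- The cocycle
`c_φ (x, m - n, y) = ∑_{i < m} φ (T^i x) - ∑_{j < n} φ (T^j y)` where `T^m x = T^n y`
(independent of the choice of `m` and `n`, see `cocycle_eq`). -/
def cocycle (φ : C(X, ℝ)) (g : DRGroupoid T) : ℝ :=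
  birkhoffSum T φ g.exists_rep.choose g.r -
    birkhoffSum T φ g.exists_rep.choose_spec.choose g.s

theorem cocycle_eq (φ : C(X, ℝ)) (g : DRGroupoid T) {m n : ℕ} (h1 : g.deg = (m : ℤ) - n)
    (h2 : T^[m] g.r = T^[n] g.s) :
    cocycle φ g = birkhoffSum T φ m g.r - birkhoffSum T φ n g.s := by
  have h := g.exists_rep.choose_spec.choose_spec
  exact cocycle_aux φ h.2 h2 (h.1.symm.trans h1)

theorem cocycle_inv (φ : C(X, ℝ)) (g : DRGroupoid T) : cocycle φ g.inv = -cocycle φ g := by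
  obtain ⟨m, n, h1, h2⟩ := g.exists_rep
  rw [cocycle_eq φ g h1 h2, cocycle_eq φ g.inv (m := n) (n := m) (by simp [h1]) h2.symm]
  simp

theorem cocycle_comp (φ : C(X, ℝ)) (g h : DRGroupoid T) (e : g.s = h.r) :
    cocycle φ (g.comp h e) = cocycle φ g + cocycle φ h := by
  obtain ⟨m, n, h1, h2⟩ := g.exists_rep
  obtain ⟨p, q, h3, h4⟩ := h.exists_rep
  have h5 : T^[m + p] (g.comp h e).r = T^[q + n] (g.comp h e).s := by
    simp only [r_comp, s_comp]
    rw [add_comm m p, Function.iterate_add_apply, h2, e, ← Function.iterate_add_apply,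
      add_comm p n, Function.iterate_add_apply, h4, ← Function.iterate_add_apply, add_comm n q]
  rw [cocycle_eq φ g h1 h2, cocycle_eq φ h h3 h4, cocycle_eq φ (g.comp h e) (m := m + p)
    (n := q + n) (by simp only [deg_comp, h1, h3]; push_cast; ring) h5]
  simp only [r_comp, s_comp]
  rw [birkhoffSum_add, birkhoffSum_add, h2, ← h4, e]
  have := birkhoffSum_add T φ n p h.r
  have := birkhoffSum_add T φ p n h.r
  rw [add_comm p n] at this
  linarith

theorem continuous_cocycle (hT : Continuous T) (φ : C(X, ℝ)) :
    Continuous (cocycle φ : DRGroupoid T → ℝ) := by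
  refine continuous_iff_continuousAt.2 fun g => ?_
  obtain ⟨m, n, h1, h2⟩ := g.exists_rep
  have ho := isOpen_basicSet (T := T) isOpen_univ isOpen_univ m n
  have hb : ∀ k, Continuous (birkhoffSum T φ k) := fun k =>
    continuous_finsetSum _ fun i _ => (map_continuous φ).comp (hT.iterate i)
  have hc : Continuous fun g : DRGroupoid T => birkhoffSum T φ m g.r - birkhoffSum T φ n g.s :=
    ((hb m).comp continuous_r).sub ((hb n).comp continuous_s)
  refine hc.continuousAt.congr ?_
  filter_upwards [ho.mem_nhds (x := g) ⟨trivial, trivial, h1, h2⟩] with a ha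
  exact (cocycle_eq φ a ha.2.2.1 ha.2.2.2).symm

/-- The linear map `f ↦ e^{itc_φ} f` on `C_c(G)`. -/
def phase (hT : IsLocalHomeomorph T) (φ : C(X, ℝ)) (t : ℝ) :
    C_c(DRGroupoid T, ℂ) →ₗ[ℂ] C_c(DRGroupoid T, ℂ) where
  toFun f := ⟨⟨fun γ => Complex.exp (Complex.I * t * cocycle φ γ) * f γ, by
      have := continuous_cocycle hT.continuous φ
      have := map_continuous f
      fun_prop⟩, f.hasCompactSupport.mul_left⟩
  map_add' f g := by ext γ; exact mul_add _ _ _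
  map_smul' a f := by ext γ; exact mul_left_comm _ _ _

theorem conv_phase [T2Space X] (hT : IsLocalHomeomorph T) (φ : C(X, ℝ)) (t : ℝ)
    (f g : C_c(DRGroupoid T, ℂ)) :
    conv hT (phase hT φ t f) (phase hT φ t g) = phase hT φ t (conv hT f g) := by
  ext γ
  change (∑ᶠ a : {a : DRGroupoid T // a.r = γ.r},
    (Complex.exp (Complex.I * t * cocycle φ a.1) * f a) *
      (Complex.exp (Complex.I * t * cocycle φ (a.1.ldiv γ a.2)) *
        g (a.1.ldiv γ a.2))) =
    Complex.exp (Complex.I * t * cocycle φ γ) *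
      ∑ᶠ a : {a : DRGroupoid T // a.r = γ.r}, f a * g (a.1.ldiv γ a.2)
  rw [← smul_eq_mul (Complex.exp _), smul_finsum]
  refine finsum_congr fun a => ?_
  have h : Complex.exp (Complex.I * t * cocycle φ γ) =
      Complex.exp (Complex.I * t * cocycle φ a.1) *
        Complex.exp (Complex.I * t * cocycle φ (a.1.ldiv γ a.2)) := by
    rw [ldiv, cocycle_comp, cocycle_inv, ← Complex.exp_add]
    congr 1
    push_cast
    ring
  rw [h, smul_eq_mul]
  ring

theorem adj_phase (hT : IsLocalHomeomorph T) (φ : C(X, ℝ)) (t : ℝ)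
    (f : C_c(DRGroupoid T, ℂ)) : adj (phase hT φ t f) = phase hT φ t (adj f) := by
  ext γ
  change star (Complex.exp (Complex.I * t * cocycle φ γ.inv) * f γ.inv) =
    Complex.exp (Complex.I * t * cocycle φ γ) * star (f γ.inv)
  rw [star_mul', Complex.star_def, ← Complex.exp_conj, cocycle_inv]
  congr 2
  simp

theorem norm_phase (hT : IsLocalHomeomorph T) (φ : C(X, ℝ)) (t : ℝ)
    (f : C_c(DRGroupoid T, ℂ)) (γ : DRGroupoid T) : ‖phase hT φ t f γ‖ = ‖f γ‖ := by
  change ‖Complex.exp (Complex.I * t * cocycle φ γ) * f γ‖ = ‖f γ‖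
  have h : Complex.I * t * cocycle φ γ = ((t * cocycle φ γ : ℝ) : ℂ) * Complex.I := by
    push_cast; ring
  rw [norm_mul, h, Complex.norm_exp_ofReal_mul_I, one_mul]

theorem normI_phase (hT : IsLocalHomeomorph T) (φ : C(X, ℝ)) (t : ℝ)
    (f : C_c(DRGroupoid T, ℂ)) : normI (phase hT φ t f) = normI f := by
  simp only [normI, norm_phase]

theorem phase_phase (hT : IsLocalHomeomorph T) (φ : C(X, ℝ)) (t t' : ℝ)
    (f : C_c(DRGroupoid T, ℂ)) : phase hT φ t (phase hT φ t' f) = phase hT φ (t + t') f := by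
  ext γ
  change Complex.exp (Complex.I * t * cocycle φ γ) *
    (Complex.exp (Complex.I * t' * cocycle φ γ) * f γ) =
    Complex.exp (Complex.I * (t + t' : ℝ) * cocycle φ γ) * f γ
  rw [← mul_assoc, ← Complex.exp_add]
  congr 2
  push_cast
  ring

theorem phase_zero (hT : IsLocalHomeomorph T) (φ : C(X, ℝ))
    (f : C_c(DRGroupoid T, ℂ)) : phase hT φ 0 f = f := by
  ext γ
  change Complex.exp (Complex.I * (0 : ℝ) * cocycle φ γ) * f γ = f γ
  simp

/-! ### The full groupoid `C*`-algebra -/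

variable [T2Space X]

/-- An `I`-norm bounded `*`-representation of the convolution algebra `C_c(G)` on a Hilbert
space. -/
structure IsRep (hT : IsLocalHomeomorph T) {H : Type u} [NormedAddCommGroup H]
    [InnerProductSpace ℂ H] [CompleteSpace H]
    (π : C_c(DRGroupoid T, ℂ) →ₗ[ℂ] (H →L[ℂ] H)) : Prop where
  map_conv : ∀ f g, π (conv hT f g) = π f * π g
  map_adj : ∀ f, π (adj f) = star (π f)
  norm_le : ∀ f, ‖π f‖ ≤ normI f

/-- The `I`-norm bounded `*`-representations of `C_c(G)`, on all Hilbert spaces (in the universe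
of `X`). -/
structure Rep (hT : IsLocalHomeomorph T) where
  H : Type u
  [normed : NormedAddCommGroup H]
  [inner : InnerProductSpace ℂ H]
  [complete : CompleteSpace H]
  π : C_c(DRGroupoid T, ℂ) →ₗ[ℂ] (H →L[ℂ] H)
  isRep : IsRep hT π

attribute [instance] Rep.normed Rep.inner Rep.complete

/-- The `ℓ^∞`-product of all `B(H_π)`. -/
def Ambient (hT : IsLocalHomeomorph T) : Type (u + 1) :=
  lp (fun π : Rep hT => π.H →L[ℂ] π.H) ∞

instance (hT : IsLocalHomeomorph T) : NonUnitalCStarAlgebra (Ambient hT) :=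
  inferInstanceAs (NonUnitalCStarAlgebra (lp (fun π : Rep hT => π.H →L[ℂ] π.H) ∞))

/-- The `π`-coordinate of an element of the product. -/
def Ambient.coord {hT : IsLocalHomeomorph T} (a : Ambient hT) (π : Rep hT) : π.H →L[ℂ] π.H :=
  (show lp (fun π : Rep hT => π.H →L[ℂ] π.H) ∞ from a) π

theorem Ambient.ext {hT : IsLocalHomeomorph T} {a b : Ambient hT}
    (h : ∀ π, a.coord π = b.coord π) : a = b :=
  lp.ext (funext h)

theorem Ambient.norm_coord_le {hT : IsLocalHomeomorph T} (a : Ambient hT) (π : Rep hT) :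
    ‖a.coord π‖ ≤ ‖a‖ :=
  lp.norm_apply_le_norm (E := fun π : Rep hT => π.H →L[ℂ] π.H) ENNReal.top_ne_zero a π

theorem memℓp_rep (hT : IsLocalHomeomorph T) (f : C_c(DRGroupoid T, ℂ)) :
    Memℓp (fun π : Rep hT => π.π f) ∞ :=
  memℓp_infty ⟨normI f, by rintro _ ⟨π, rfl⟩; exact π.isRep.norm_le f⟩

/-- The universal representation of `C_c(G)`, `f ↦ (π(f))_π`. Its norm is the full norm
`‖f‖ = sup_π ‖π(f)‖`. -/
def univRep (hT : IsLocalHomeomorph T) : C_c(DRGroupoid T, ℂ) →ₗ[ℂ] Ambient hT where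
  toFun f := ⟨fun π => π.π f, memℓp_rep hT f⟩
  map_add' f g := Ambient.ext fun π => map_add π.π f g
  map_smul' a f := Ambient.ext fun π => map_smul π.π a f

theorem univRep_conv (hT : IsLocalHomeomorph T) (f g : C_c(DRGroupoid T, ℂ)) :
    univRep hT (conv hT f g) = univRep hT f * univRep hT g := by
  exact Ambient.ext fun π => π.isRep.map_conv f g

theorem univRep_adj (hT : IsLocalHomeomorph T) (f : C_c(DRGroupoid T, ℂ)) :
    univRep hT (adj f) = star (univRep hT f) := by
  exact Ambient.ext fun π => π.isRep.map_adj f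

/-- The image of `C_c(G)` under the universal representation. -/
def core (hT : IsLocalHomeomorph T) : NonUnitalStarSubalgebra ℂ (Ambient hT) where
  carrier := range (univRep hT)
  add_mem' := by
    rintro _ _ ⟨f, rfl⟩ ⟨g, rfl⟩; exact ⟨f + g, map_add _ f g⟩
  zero_mem' := ⟨0, map_zero _⟩
  mul_mem' := by
    rintro _ _ ⟨f, rfl⟩ ⟨g, rfl⟩; exact ⟨conv hT f g, univRep_conv hT f g⟩
  smul_mem' := by
    rintro a _ ⟨f, rfl⟩; exact ⟨a • f, map_smul _ a f⟩
  star_mem' := by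
    rintro _ ⟨f, rfl⟩; exact ⟨adj f, univRep_adj hT f⟩

/-- The full groupoid `C*`-algebra `C*(G(X, T))`: the completion of `C_c(G)` in the full norm,
realized as the closure of the image of the universal representation. -/
def CStar (hT : IsLocalHomeomorph T) : Type (u + 1) :=
  ↥(core hT).topologicalClosure

instance (hT : IsLocalHomeomorph T) : NonUnitalCStarAlgebra (CStar hT) :=
  have : IsClosed ((core hT).topologicalClosure : Set (Ambient hT)) :=
    (core hT).isClosed_topologicalClosure
  inferInstanceAs (NonUnitalCStarAlgebra ↥(core hT).topologicalClosure)

/-- The canonical map `C_c(G) → C*(G)`. -/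
def toCStar (hT : IsLocalHomeomorph T) : C_c(DRGroupoid T, ℂ) →ₗ[ℂ] CStar hT where
  toFun f := ⟨univRep hT f, (core hT).le_topologicalClosure ⟨f, rfl⟩⟩
  map_add' f g := Subtype.ext (map_add _ f g)
  map_smul' a f := Subtype.ext (map_smul _ a f)

/-! ### The one-parameter group -/

/-- The representation `f ↦ π(e^{itc_φ} f)`. -/
def Rep.twist {hT : IsLocalHomeomorph T} (φ : C(X, ℝ)) (t : ℝ) (π : Rep hT) : Rep hT where
  H := π.H
  π := π.π ∘ₗ phase hT φ t
  isRep :=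
    { map_conv := fun f g => by
        simp only [LinearMap.comp_apply]
        rw [← conv_phase, π.isRep.map_conv]
      map_adj := fun f => by
        simp only [LinearMap.comp_apply]
        rw [← adj_phase, π.isRep.map_adj]
      norm_le := fun f => by
        simp only [LinearMap.comp_apply]
        exact (π.isRep.norm_le _).trans_eq (normI_phase hT φ t f) }

theorem memℓp_twist {hT : IsLocalHomeomorph T} (φ : C(X, ℝ)) (t : ℝ) (a : Ambient hT) :
    Memℓp (fun π : Rep hT => (a.coord (π.twist φ t) : π.H →L[ℂ] π.H)) ∞ :=
  memℓp_infty ⟨‖a‖, by rintro _ ⟨π, rfl⟩; exact a.norm_coord_le (π.twist φ t)⟩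

/-- The automorphism `(a_π)_π ↦ (a_{π ∘ e^{itc_φ}})_π` of the product. -/
def ambientHom (hT : IsLocalHomeomorph T) (φ : C(X, ℝ)) (t : ℝ) :
    Ambient hT →⋆ₙₐ[ℂ] Ambient hT where
  toFun a := ⟨fun π => (a.coord (π.twist φ t) : π.H →L[ℂ] π.H), memℓp_twist φ t a⟩
  map_smul' _ _ := Ambient.ext fun _ => rfl
  map_zero' := Ambient.ext fun _ => rfl
  map_add' _ _ := Ambient.ext fun _ => rfl
  map_mul' _ _ := Ambient.ext fun _ => rfl
  map_star' _ := Ambient.ext fun _ => rfl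

theorem ambientHom_univRep (hT : IsLocalHomeomorph T) (φ : C(X, ℝ)) (t : ℝ)
    (f : C_c(DRGroupoid T, ℂ)) :
    ambientHom hT φ t (univRep hT f) = univRep hT (phase hT φ t f) := rfl

theorem continuous_ambientHom (hT : IsLocalHomeomorph T) (φ : C(X, ℝ)) (t : ℝ) :
    Continuous (ambientHom hT φ t) := by
  refine AddMonoidHomClass.continuous_of_bound (ambientHom hT φ t) 1 fun a => ?_
  rw [one_mul]
  exact lp.norm_le_of_forall_le (E := fun π : Rep hT => π.H →L[ℂ] π.H) (norm_nonneg a)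
    fun π => a.norm_coord_le (π.twist φ t)

theorem ambientHom_mem (hT : IsLocalHomeomorph T) (φ : C(X, ℝ)) (t : ℝ) {a : Ambient hT}
    (ha : a ∈ (core hT).topologicalClosure) :
    ambientHom hT φ t a ∈ (core hT).topologicalClosure := by
  refine map_mem_closure (continuous_ambientHom hT φ t) ha ?_
  rintro _ ⟨f, rfl⟩
  exact ⟨phase hT φ t f, rfl⟩

theorem coord_congr {hT : IsLocalHomeomorph T} (a : Ambient hT) {H : Type u}
    [NormedAddCommGroup H] [InnerProductSpace ℂ H] [CompleteSpace H]
    {ρ ρ' : C_c(DRGroupoid T, ℂ) →ₗ[ℂ] (H →L[ℂ] H)} (hρ : IsRep hT ρ) (hρ' : IsRep hT ρ')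
    (h : ρ = ρ') : (a.coord ⟨H, ρ, hρ⟩ : H →L[ℂ] H) = a.coord ⟨H, ρ', hρ'⟩ := by
  subst h; rfl

theorem ambientHom_add (hT : IsLocalHomeomorph T) (φ : C(X, ℝ)) (t t' : ℝ) (a : Ambient hT) :
    ambientHom hT φ (t + t') a = ambientHom hT φ t (ambientHom hT φ t' a) := by
  refine Ambient.ext fun π => coord_congr a (π.twist φ (t + t')).isRep
    ((π.twist φ t).twist φ t').isRep ?_
  ext1 f
  exact congrArg π.π (phase_phase hT φ t t' f).symm

theorem ambientHom_zero (hT : IsLocalHomeomorph T) (φ : C(X, ℝ)) (a : Ambient hT) :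
    ambientHom hT φ 0 a = a := by
  refine Ambient.ext fun π => coord_congr a (π.twist φ 0).isRep π.isRep ?_
  ext1 f
  exact congrArg π.π (phase_zero hT φ f)

/-- The action `α` of `ℝ` on `C*(G)` associated with the cocycle `c_φ`; on `C_c(G)` it is
`α_t(f)(γ) = e^{itc_φ(γ)} f(γ)`, see `action_toCStar`. -/
def action (hT : IsLocalHomeomorph T) (φ : C(X, ℝ)) (t : ℝ) : CStar hT ≃⋆ₐ[ℂ] CStar hT where
  toFun a := ⟨ambientHom hT φ t a.1, ambientHom_mem hT φ t a.2⟩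
  invFun a := ⟨ambientHom hT φ (-t) a.1, ambientHom_mem hT φ (-t) a.2⟩
  left_inv a := Subtype.ext ((ambientHom_add hT φ (-t) t a.1).symm.trans
    (by rw [neg_add_cancel, ambientHom_zero]))
  right_inv a := Subtype.ext ((ambientHom_add hT φ t (-t) a.1).symm.trans
    (by rw [add_neg_cancel, ambientHom_zero]))
  map_mul' a b := Subtype.ext (map_mul _ a.1 b.1)
  map_add' a b := Subtype.ext (map_add _ a.1 b.1)
  map_star' a := Subtype.ext (map_star _ a.1)
  map_smul' c a := Subtype.ext (map_smul _ c a.1)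

theorem action_toCStar (hT : IsLocalHomeomorph T) (φ : C(X, ℝ)) (t : ℝ)
    (f : C_c(DRGroupoid T, ℂ)) :
    action hT φ t (toCStar hT f) = toCStar hT (phase hT φ t f) := rfl

theorem action_add (hT : IsLocalHomeomorph T) (φ : C(X, ℝ)) (t t' : ℝ) (a : CStar hT) :
    action hT φ (t + t') a = action hT φ t (action hT φ t' a) :=
  Subtype.ext (ambientHom_add hT φ t t' a.1)

/-! ### States and the KMS condition -/

/-- A state of a `C*`-algebra: a positive linear functional of norm one. -/
structure IsState {A : Type*} [NonUnitalCStarAlgebra A] (ω : A →L[ℂ] ℂ) : Prop where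
  nonneg : ∀ a, 0 ≤ ω (star a * a)
  norm_eq_one : ‖ω‖ = 1

/-- The KMS condition at inverse temperature `β`: `ω(b α_{iβ}(a)) = ω(a b)` for all `b` and all
`a` that are entire for `α`, that is, for which `t ↦ α_t(a)` extends to an entire function `F`
(necessarily unique; then `α_{iβ}(a) = F(iβ)`). At `β = 0` this only says that `ω` is a trace, and
the `α`-invariance of `ω`, automatic for `β ≠ 0`, is by convention part of the condition. -/
structure IsKMS {A : Type*} [NonUnitalCStarAlgebra A] (α : ℝ → A ≃⋆ₐ[ℂ] A) (β : ℝ)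
    (ω : A →L[ℂ] ℂ) : Prop where
  kms : ∀ (a b : A) (F : ℂ → A), Differentiable ℂ F → (∀ t : ℝ, F t = α t a) →
    ω (b * F (Complex.I * β)) = ω (a * b)
  invariant_of_zero : β = 0 → ∀ (t : ℝ) (a : A), ω (α t a) = ω a

/-! ### Measures -/

instance : MeasurableSpace (DRGroupoid T) := borel _
instance : BorelSpace (DRGroupoid T) := ⟨rfl⟩

variable [MeasurableSpace X]

/-- The measure `r^*μ = ∫ λ^x dμ(x)`, where `λ^x` is counting measure on `r⁻¹(x)`. -/
def rStar (T : X → X) (μ : Measure X) : Measure (DRGroupoid T) :=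
  μ.bind fun x => Measure.count.restrict (r ⁻¹' {x})

/-- The measure `s^*μ = ∫ λ_x dμ(x)`, where `λ_x` is counting measure on `s⁻¹(x)`. -/
def sStar (T : X → X) (μ : Measure X) : Measure (DRGroupoid T) :=
  μ.bind fun x => Measure.count.restrict (s ⁻¹' {x})

variable [BorelSpace X]

/-- The family of counting measures on the fibres of `r` is measurable. -/
theorem measurable_count_r [SecondCountableTopology X] (hT : IsLocalHomeomorph T) :
    Measurable fun x : X => (Measure.count : Measure (DRGroupoid T)).restrict (r ⁻¹' {x}) := by
  set S : Set (Set (DRGroupoid T)) := insert ∅ {B | ∃ (m n : ℕ) (V : Set X),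
    V ∈ TopologicalSpace.countableBasis X ∧ InjOn (T^[n]) V ∧ B = basicSet T univ m n V} with hS
  have hScount : S.Countable := by
    refine Countable.insert _ ?_
    refine ((countable_univ (α := ℕ)).prod ((countable_univ (α := ℕ)).prod
      (TopologicalSpace.countable_countableBasis X))).image
      (fun p => basicSet T univ p.1 p.2.1 p.2.2) |>.mono ?_
    rintro _ ⟨m, n, V, hV, -, rfl⟩
    exact ⟨(m, n, V), ⟨trivial, trivial, hV⟩, rfl⟩
  obtain ⟨B, hB⟩ := hScount.exists_eq_range ⟨∅, mem_insert _ _⟩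
  have hBo : ∀ i, IsOpen (B i) ∧ InjOn r (B i) := by
    intro i
    have hi : B i ∈ S := hB ▸ mem_range_self i
    rcases hi with hi | ⟨m, n, V, hV, hinj, hi⟩
    · rw [hi]; exact ⟨isOpen_empty, injOn_empty _⟩
    · rw [hi]
      refine ⟨isOpen_basicSet isOpen_univ (TopologicalSpace.isOpen_of_mem_countableBasis hV) m n,
        fun a ha b hb hab => ext' hab (ha.2.2.1.trans hb.2.2.1.symm)
          (hinj ha.2.1 hb.2.1 ?_)⟩
      rw [← ha.2.2.2, ← hb.2.2.2, hab]
  have hcov : ⋃ i, B i = univ := by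
    refine eq_univ_of_forall fun g => ?_
    obtain ⟨m, n, h1, h2⟩ := g.exists_rep
    obtain ⟨O, hO, hgO, hinj⟩ := exists_injOn hT n g.s
    obtain ⟨V, hV, hgV, hVO⟩ :=
      (TopologicalSpace.isBasis_countableBasis X).exists_subset_of_mem_open hgO hO
    have : basicSet T univ m n V ∈ range B := hB ▸ Or.inr ⟨m, n, V, hV, hinj.mono hVO, rfl⟩
    obtain ⟨i, hi⟩ := this
    exact mem_iUnion.2 ⟨i, hi ▸ ⟨trivial, hgV, h1, h2⟩⟩
  have himg : ∀ i (E : Set (DRGroupoid T)), MeasurableSet E → MeasurableSet (r '' (E ∩ B i)) := by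
    intro i E hE
    have hemb : IsOpenEmbedding fun b : B i => r b.1 :=
      IsOpenEmbedding.of_continuous_injective_isOpenMap
        (continuous_r.comp continuous_subtype_val)
        (fun a b hab => Subtype.ext ((hBo i).2 a.2 b.2 hab))
        ((isOpenMap_r hT).domRestrict (hBo i).1)
    have := hemb.measurableEmbedding.measurableSet_image.2 (measurable_subtype_coe hE)
    convert this using 1
    ext x
    simp only [mem_image, mem_inter_iff, mem_preimage, Subtype.exists]
    constructor
    · rintro ⟨a, ⟨h1, h2⟩, h3⟩; exact ⟨a, h2, h1, h3⟩
    · rintro ⟨a, h1, h2, h3⟩; exact ⟨a, ⟨h2, h1⟩, h3⟩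
  have hdm : ∀ i, MeasurableSet (disjointed B i) :=
    MeasurableSet.disjointed fun i => (hBo i).1.measurableSet
  refine Measure.measurable_of_measurable_coe _ fun E hE => ?_
  have heq : ∀ x, (Measure.count : Measure (DRGroupoid T)).restrict (r ⁻¹' {x}) E =
      ∑' i, (r '' ((E ∩ disjointed B i) ∩ B i)).indicator (fun _ => (1 : ℝ≥0∞)) x := by
    intro x
    have hx : MeasurableSet (r ⁻¹' {x} : Set (DRGroupoid T)) :=
      continuous_r.measurable (measurableSet_singleton x)
    have hE' : E ∩ r ⁻¹' {x} = ⋃ i, (E ∩ r ⁻¹' {x}) ∩ disjointed B i := by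
      rw [← inter_iUnion, iUnion_disjointed, hcov, inter_univ]
    rw [Measure.restrict_apply hE, hE', measure_iUnion
      (fun i j hij => ((disjoint_disjointed B) hij).mono inter_subset_right inter_subset_right)
      (fun i => (hE.inter hx).inter (hdm i))]
    refine tsum_congr fun i => ?_
    by_cases h : x ∈ r '' ((E ∩ disjointed B i) ∩ B i)
    · rw [indicator_of_mem h]
      obtain ⟨a, ⟨⟨ha1, ha2⟩, ha3⟩, rfl⟩ := h
      have : E ∩ r ⁻¹' {a.r} ∩ disjointed B i = {a} := by
        refine Subset.antisymm ?_ (by rintro _ rfl; exact ⟨⟨ha1, rfl⟩, ha2⟩)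
        rintro b ⟨⟨hb1, hb2⟩, hb3⟩
        exact (hBo i).2 (disjointed_subset B i hb3) ha3 hb2
      rw [this, Measure.count_singleton]
    · rw [indicator_of_notMem h]
      have : E ∩ r ⁻¹' {x} ∩ disjointed B i = ∅ := by
        refine eq_empty_of_forall_notMem ?_
        rintro b ⟨⟨hb1, hb2⟩, hb3⟩
        exact h ⟨b, ⟨⟨hb1, hb3⟩, disjointed_subset B i hb3⟩, hb2⟩
      rw [this, measure_empty]
  simp_rw [heq]
  exact Measurable.tsum fun i =>
    measurable_const.indicator (himg i _ (hE.inter (hdm i)))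

/-- The family of counting measures on the fibres of `s` is measurable. -/
theorem measurable_count_s [SecondCountableTopology X] (hT : IsLocalHomeomorph T) :
    Measurable fun x : X => (Measure.count : Measure (DRGroupoid T)).restrict (s ⁻¹' {x}) := by
  refine Measure.measurable_of_measurable_coe _ fun E hE => ?_
  have hinv : ∀ g : DRGroupoid T, g.inv.inv = g := fun g => ext' rfl (neg_neg _) rfl
  have hE' : MeasurableSet (inv ⁻¹' E : Set (DRGroupoid T)) := continuous_inv.measurable hE
  have heq : ∀ x, (Measure.count : Measure (DRGroupoid T)).restrict (s ⁻¹' {x}) E =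
      (Measure.count : Measure (DRGroupoid T)).restrict (r ⁻¹' {x}) (inv ⁻¹' E) := by
    intro x
    rw [Measure.restrict_apply hE, Measure.restrict_apply hE']
    have : E ∩ s ⁻¹' {x} = inv '' (inv ⁻¹' E ∩ r ⁻¹' {x}) := by
      ext g
      constructor
      · rintro ⟨h1, h2⟩
        exact ⟨g.inv, ⟨by rw [mem_preimage, hinv]; exact h1, h2⟩, hinv g⟩
      · rintro ⟨a, ⟨h1, h2⟩, rfl⟩; exact ⟨h1, h2⟩
    rw [this]
    exact Measure.count_injective_image (Function.LeftInverse.injective hinv) _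
  simp_rw [heq]
  exact Measure.measurable_coe hE' |>.comp (measurable_count_r hT)

/-- `μ` is quasi-invariant: `r^*μ` and `s^*μ` are mutually absolutely continuous. -/
def IsQuasiInvariant (T : X → X) (μ : Measure X) : Prop :=
  rStar T μ ≪ sStar T μ ∧ sStar T μ ≪ rStar T μ

/-- The Radon–Nikodym derivative `dr^*μ/ds^*μ` equals `D`. -/
def HasModularFunction (T : X → X) (μ : Measure X) (D : DRGroupoid T → ℝ) : Prop :=
  rStar T μ = (sStar T μ).withDensity fun γ => ENNReal.ofReal (D γ)

/-- `ω = ω_μ`, the functional on `C*(G)` determined by `ω_μ(f) = ∫ f(x, 0, x) dμ(x)` for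
`f ∈ C_c(G)` (the image of `C_c(G)` is dense). -/
def IsIntegrationState (hT : IsLocalHomeomorph T) (μ : Measure X) (ω : CStar hT →L[ℂ] ℂ) : Prop :=
  ∀ f : C_c(DRGroupoid T, ℂ), ω (toCStar hT f) = ∫ x, f (unit T x) ∂μ

/-- A subgroupoid (given by its set of arrows) is principal if `(r, s)` is injective on it. -/
def IsPrincipal (S : Set (DRGroupoid T)) : Prop :=
  InjOn (fun γ : DRGroupoid T => (γ.r, γ.s)) S

end DRGroupoid
end

noncomputable section

open Set Filter Topology MeasureTheory
open scoped CompactlySupported ENNReal ComplexOrder ContinuousMap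

universe u

namespace DRGroupoid

variable {X : Type u} {T : X → X}

/-! Elements of `C_c(G)` are entire, with `α_z(f) = e^{izc_φ} f`, so the KMS condition on them reads
`ω(g * e^{-βc_φ} f) = ω(f * g)` (`IsKMS.apply_conv`). It is used three times.

With `g` the unit of `C*(G)` it gives `ω(e^{-βc_φ} f) = ω(f)`. Dividing by `e^{-βc_φ} - 1` shows
that `ω` kills functions supported where `c_φ ≠ 0`. For `β = 0` this says nothing, and invariance
under `α_t` takes its place. Next, functions on the unit space are fixed by `α`, so `ω(k * f) = ω(f
* k)` for `k ∈ C(X)`. Separating `r` from `s` by such a `k` shows that `ω` vanishes near every arrow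
with `r ≠ s`. Principality of `c_φ⁻¹(0)` leaves only units, and a partition of unity globalizes
this: `ω(f)` depends only on the restriction of `f` to `X` (`IsKMS.apply_eq_apply_ofUnits`). The
Riesz theorem then provides `μ` (`IsState.exists_measure`).

Finally, take `g` with `g(γ⁻¹) = 1` wherever `f(γ) ≠ 0`. On units, `f * g` is the sum of `f` over an
`r`-fibre, and `g * (e^{-βc_φ} f)` is the sum of `e^{-βc_φ} f` over an `s`-fibre. The KMS identity
becomes `∫ f dr^*μ = ∫ e^{-βc_φ} f ds^*μ`, and locally finite measures on `G` are determined by such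
integrals (`IsIntegrationState.hasModularFunction`). Quasi-invariance follows because the density is
positive. -/

theorem range_unit : range (unit T) = basicSet T univ 0 0 univ := by
  ext γ
  constructor
  · rintro ⟨x, rfl⟩; exact ⟨trivial, trivial, by simp, rfl⟩
  · rintro ⟨-, -, h1, h2⟩
    exact ⟨γ.r, ext' rfl (by simp [h1]) h2⟩

theorem inv_inv (γ : DRGroupoid T) : γ.inv.inv = γ := ext' rfl (neg_neg _) rfl

/-! ### Topology of the groupoid and of its unit space. -/

section Topology

variable [TopologicalSpace X]

/-- Compact neighbourhoods lift from `X` through local inverses of `r`. Partitions of unity and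
cutoff functions on `G` rest on this. -/
theorem locallyCompactSpace [LocallyCompactSpace X] [T2Space X] (hT : IsLocalHomeomorph T) :
    LocallyCompactSpace (DRGroupoid T) := by
  have : WeaklyLocallyCompactSpace (DRGroupoid T) := by
    refine ⟨fun a => ?_⟩
    obtain ⟨e, ha, he⟩ := isLocalHomeomorph_r hT a
    obtain ⟨K, hK, hKs, hKc⟩ := local_compact_nhds (e.open_target.mem_nhds (e.map_source ha))
    refine ⟨e.symm '' K, hKc.image_of_continuousOn (e.continuousOn_symm.mono hKs), ?_⟩
    have h := e.symm.image_mem_nhds (e.map_source ha) hK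
    rwa [e.left_inv ha] at h
  infer_instance

theorem secondCountableTopology [SecondCountableTopology X] :
    SecondCountableTopology (DRGroupoid T) := by
  have hB := TopologicalSpace.isBasis_countableBasis X
  refine (TopologicalSpace.IsTopologicalBasis.secondCountableTopology (b := (fun p :
    ℕ × ℕ × Set X × Set X => basicSet T p.2.2.1 p.1 p.2.1 p.2.2.2) ''
      (univ ×ˢ univ ×ˢ TopologicalSpace.countableBasis X ×ˢ TopologicalSpace.countableBasis X))
    (TopologicalSpace.isTopologicalBasis_of_isOpen_of_nhds ?_ ?_) ?_)
  · rintro _ ⟨⟨m, n, U, V⟩, ⟨-, -, hU, hV⟩, rfl⟩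
    exact isOpen_basicSet (hB.isOpen hU) (hB.isOpen hV) m n
  · intro a O ha hO
    obtain ⟨_, ⟨U, V, m, n, hU, hV, rfl⟩, ⟨h1, h2, h3⟩, hsub⟩ :=
      isTopologicalBasis.exists_subset_of_mem_open ha hO
    obtain ⟨U', hU', haU, hUs⟩ := hB.exists_subset_of_mem_open h1 hU
    obtain ⟨V', hV', haV, hVs⟩ := hB.exists_subset_of_mem_open h2 hV
    refine ⟨_, ⟨(m, n, U', V'), ⟨trivial, trivial, hU', hV'⟩, rfl⟩, ⟨haU, haV, h3⟩, ?_⟩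
    rintro b ⟨hb1, hb2, hb3⟩
    exact hsub ⟨hUs hb1, hVs hb2, hb3⟩
  · exact (countable_univ.prod (countable_univ.prod
      ((TopologicalSpace.countable_countableBasis X).prod
        (TopologicalSpace.countable_countableBasis X)))).image _

theorem isOpen_range_unit : IsOpen (range (unit T)) :=
  range_unit (T := T) ▸ isOpen_basicSet isOpen_univ isOpen_univ 0 0

theorem continuous_unit : Continuous (unit T) := by
  refine continuous_generateFrom_iff.2 ?_
  rintro _ ⟨U, V, m, n, hU, hV, rfl⟩
  by_cases h : m = n
  · convert hU.inter hV using 1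
    ext x
    simp [basicSet, h]
  · convert isOpen_empty using 1
    ext x
    simp only [basicSet, mem_preimage, mem_ofPred_eq, deg_unit, mem_empty_iff_false, iff_false]
    rintro ⟨-, -, h', -⟩
    omega

theorem isCompact_range_unit [CompactSpace X] : IsCompact (range (unit T)) :=
  isCompact_range continuous_unit

/-- This is what lets a continuous function on `X` be extended by zero to a continuous function on
`G`. -/
theorem isClopen_range_unit [CompactSpace X] [T2Space X] : IsClopen (range (unit T)) :=
  ⟨isCompact_range_unit.isClosed, isOpen_range_unit⟩

theorem cocycle_unit (φ : C(X, ℝ)) (x : X) : cocycle φ (unit T x) = 0 := by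
  rw [cocycle_eq φ (unit T x) (m := 0) (n := 0) (by simp) rfl]
  simp

end Topology

/-! ### Entire elements and the KMS condition on `C_c(G)`. -/

section Analytic

variable [TopologicalSpace X]

theorem normI_nonneg (f : C_c(DRGroupoid T, ℂ)) : 0 ≤ normI f :=
  le_max_of_le_left (Real.iSup_nonneg fun _ => finsum_nonneg fun _ => norm_nonneg _)

/-- The function `e^{izc_φ}` for complex `z`. -/
def expCocycle (hT : IsLocalHomeomorph T) (φ : C(X, ℝ)) (z : ℂ) : C(DRGroupoid T, ℂ) :=
  ⟨fun γ => Complex.exp (Complex.I * z * cocycle φ γ), by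
    have := continuous_cocycle hT.continuous φ
    fun_prop⟩

theorem expCocycle_apply (hT : IsLocalHomeomorph T) (φ : C(X, ℝ)) (z : ℂ) (γ : DRGroupoid T) :
    expCocycle hT φ z γ = Complex.exp (Complex.I * z * cocycle φ γ) := rfl

variable [T2Space X]

theorem hasFiniteSupport_r (hT : IsLocalHomeomorph T) (f : C_c(DRGroupoid T, ℂ)) (x : X) :
    (Function.support fun γ : {γ : DRGroupoid T // γ.r = x} => f γ.1).Finite :=
  ((finite_fiber hT f.hasCompactSupport x).preimage Subtype.val_injective.injOn).subset
    fun γ hγ => ⟨subset_tsupport _ hγ, γ.2⟩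

/-- Inversion exchanges the fibres of `r` and `s`, which reduces this to the `r`-fibres of `adj f`.
-/
theorem hasFiniteSupport_s (hT : IsLocalHomeomorph T) (f : C_c(DRGroupoid T, ℂ)) (x : X) :
    (Function.support fun γ : {γ : DRGroupoid T // γ.s = x} => f γ.1).Finite := by
  refine ((hasFiniteSupport_r hT (adj f) x).preimage (f := fun γ : {γ : DRGroupoid T // γ.s = x} =>
    (⟨γ.1.inv, γ.2⟩ : {γ : DRGroupoid T // γ.r = x})) ?_).subset fun γ hγ => ?_
  · intro a _ b _ h
    have h' : a.1.inv = b.1.inv := congrArg Subtype.val h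
    exact Subtype.ext (by rw [← inv_inv a.1, h', inv_inv])
  · change star (f γ.1.inv.inv) ≠ 0
    rw [inv_inv]
    exact star_ne_zero.2 hγ

/-- The `I`-norm is monotone in the absolute value. -/
theorem normI_le_of_forall_le (hT : IsLocalHomeomorph T) {f g : C_c(DRGroupoid T, ℂ)} {K : ℝ}
    (hK : 0 ≤ K) (h : ∀ γ, ‖f γ‖ ≤ K * ‖g γ‖) : normI f ≤ K * normI g := by
  have hnn : ∀ (p : DRGroupoid T → Prop), 0 ≤ ∑ᶠ γ : {γ // p γ}, ‖g γ‖ := fun p =>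
    finsum_nonneg fun _ => norm_nonneg _
  have h0 : 0 ≤ normI g := le_max_of_le_left (Real.iSup_nonneg fun x => hnn _)
  refine max_le (Real.iSup_le (fun x => ?_) (mul_nonneg hK h0))
    (Real.iSup_le (fun x => ?_) (mul_nonneg hK h0))
  · refine le_trans ?_ (mul_le_mul_of_nonneg_left ((le_ciSup (bddAbove_normI_r hT g) x).trans
      (le_max_left _ _)) hK)
    rw [← smul_eq_mul, smul_finsum]
    refine finsum_le_finsum' ?_ ?_ fun γ => h γ.1
    · exact (hasFiniteSupport_r hT f x).subset fun γ hγ => norm_ne_zero_iff.1 hγ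
    · exact (hasFiniteSupport_r hT g x).subset
        fun γ hγ => norm_ne_zero_iff.1 (right_ne_zero_of_mul hγ)
  · refine le_trans ?_ (mul_le_mul_of_nonneg_left ((le_ciSup (bddAbove_normI_s hT g) x).trans
      (le_max_right _ _)) hK)
    rw [← smul_eq_mul, smul_finsum]
    refine finsum_le_finsum' ?_ ?_ fun γ => h γ.1
    · exact (hasFiniteSupport_s hT f x).subset fun γ hγ => norm_ne_zero_iff.1 hγ
    · exact (hasFiniteSupport_s hT g x).subset
        fun γ hγ => norm_ne_zero_iff.1 (right_ne_zero_of_mul hγ)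

theorem norm_toCStar_le (hT : IsLocalHomeomorph T) (f : C_c(DRGroupoid T, ℂ)) :
    ‖toCStar hT f‖ ≤ normI f :=
  lp.norm_le_of_forall_le (E := fun π : Rep hT => π.H →L[ℂ] π.H) (normI_nonneg f)
    fun π => π.isRep.norm_le f

theorem toCStar_conv (hT : IsLocalHomeomorph T) (f g : C_c(DRGroupoid T, ℂ)) :
    toCStar hT (conv hT f g) = toCStar hT f * toCStar hT g :=
  Subtype.ext (univRep_conv hT f g)

theorem toCStar_adj (hT : IsLocalHomeomorph T) (f : C_c(DRGroupoid T, ℂ)) :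
    toCStar hT (adj f) = star (toCStar hT f) :=
  Subtype.ext (univRep_adj hT f)

/-- The elements of `C_c(G)` are entire for the action. -/
theorem differentiable_toCStar_expCocycle (hT : IsLocalHomeomorph T) (φ : C(X, ℝ))
    (f : C_c(DRGroupoid T, ℂ)) :
    Differentiable ℂ fun z => toCStar hT (expCocycle hT φ z • f) := by
  intro z
  set c : C(DRGroupoid T, ℂ) := ⟨fun γ => Complex.I * cocycle φ γ, by
    have := continuous_cocycle hT.continuous φ
    fun_prop⟩ with hc
  have hcoe : ∀ γ, c γ = Complex.I * cocycle φ γ := fun γ => rfl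
  set f' := expCocycle hT φ z • f with hf'
  obtain ⟨M, hM⟩ := (map_continuous (c • f')).bounded_above_of_compact_support
    (c • f').hasCompactSupport
  obtain ⟨C, hC⟩ : ∃ C : ℝ, ∀ γ ∈ tsupport f', ‖c γ‖ ≤ C :=
    (f'.hasCompactSupport.isCompact.exists_bound_of_continuousOn (map_continuous c).continuousOn)
  -- The maximum with `1` keeps `D` positive, so that the ball of radius `D⁻¹` makes sense even if
  -- `c` vanishes on the support.
  set D := max C 1
  have hD : ∀ γ, f' γ ≠ 0 → ‖c γ‖ ≤ D := fun γ hγ =>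
    (hC γ (subset_tsupport _ hγ)).trans (le_max_left _ _)
  have hD0 : 0 < D := lt_max_of_lt_right one_pos
  refine HasDerivAt.differentiableAt (f' := toCStar hT (c • f')) ?_
  rw [hasDerivAt_iff_isLittleO_nhds_zero]
  -- The remainder is `O(h²)` in the `I`-norm: pointwise it is `(e^w - 1 - w) f'` with `w = h c(γ)`,
  -- and `|e^w - 1 - w| ≤ |w|²` for `|w| ≤ 1`.
  refine Asymptotics.IsBigO.trans_isLittleO (g := fun h : ℂ => h ^ 2) ?_
    (by simpa using Asymptotics.isLittleO_pow_pow (𝕜 := ℂ) (m := 1) (n := 2) one_lt_two)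
  refine Asymptotics.IsBigO.of_bound (D ^ 2 * normI f') ?_
  filter_upwards [Metric.ball_mem_nhds (0 : ℂ) (inv_pos.2 hD0)] with h hh
  rw [mem_ball_zero_iff] at hh
  rw [← map_smul, ← map_sub, ← map_sub]
  refine (norm_toCStar_le hT _).trans ?_
  rw [norm_pow, mul_right_comm]
  refine normI_le_of_forall_le hT (by positivity) fun γ => ?_
  have key : (expCocycle hT φ (z + h) • f - f' - h • c • f') γ =
      (Complex.exp (h * c γ) - 1 - h * c γ) * f' γ := by
    simp only [hf', CompactlySupportedContinuousMap.coe_sub, Pi.sub_apply,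
      CompactlySupportedContinuousMap.coe_smul, Pi.smul_apply,
      CompactlySupportedContinuousMap.smulc_apply, smul_eq_mul, expCocycle_apply, hcoe]
    have : Complex.I * (z + h) * cocycle φ γ =
      Complex.I * z * cocycle φ γ + h * (Complex.I * cocycle φ γ) := by ring
    rw [this, Complex.exp_add]
    ring
  rw [key, norm_mul]
  by_cases hγ : f' γ = 0
  · simp [hγ]
  refine mul_le_mul_of_nonneg_right ?_ (norm_nonneg _)
  have h1 : ‖h * c γ‖ ≤ ‖h‖ * D := by
    rw [norm_mul]; exact mul_le_mul_of_nonneg_left (hD γ hγ) (norm_nonneg _)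
  have h2 : ‖h‖ * D ≤ 1 := by
    rw [← le_div_iff₀ hD0, one_div]; exact hh.le
  refine (Complex.norm_exp_sub_one_sub_id_le (h1.trans h2)).trans ?_
  rw [← mul_pow, mul_comm D]
  exact pow_le_pow_left₀ (norm_nonneg _) h1 2

/-- The entire extension of `t ↦ α_t(f)` is `z ↦ e^{izc_φ} f`. At `z = iβ` the factor is
`e^{-βc_φ}`. -/
theorem IsKMS.apply_conv {hT : IsLocalHomeomorph T} {φ : C(X, ℝ)} {β : ℝ} {ω : CStar hT →L[ℂ] ℂ}
    (h : IsKMS (action hT φ) β ω) (f g : C_c(DRGroupoid T, ℂ)) :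
    ω (toCStar hT (conv hT g (expCocycle hT φ (Complex.I * β) • f))) =
      ω (toCStar hT (conv hT f g)) := by
  rw [toCStar_conv, toCStar_conv]
  exact h.kms (toCStar hT f) (toCStar hT g) _ (differentiable_toCStar_expCocycle hT φ f)
    fun t => rfl

end Analytic

end DRGroupoid

/-! ### Supports of linear functionals on `C_c(Y)`. -/

/-- A linear functional on `C_c(Y)` that vanishes locally on the support of `f` vanishes at `f`. -/
theorem CompactlySupportedContinuousMap.apply_eq_zero_of_locally {Y : Type*} [TopologicalSpace Y]
    [T2Space Y] [LocallyCompactSpace Y] (L : C_c(Y, ℂ) →ₗ[ℂ] ℂ) (f : C_c(Y, ℂ))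
    (h : ∀ y ∈ tsupport f, ∃ U, IsOpen U ∧ y ∈ U ∧ ∀ g : C_c(Y, ℂ), tsupport g ⊆ U → L g = 0) :
    L f = 0 := by
  choose! U hU hyU hL using h
  obtain ⟨I, hI⟩ := f.hasCompactSupport.isCompact.elim_finite_subcover
    (fun y : tsupport f => U y) (fun y => hU y y.2) fun y hy => mem_iUnion.2 ⟨⟨y, hy⟩, hyU y hy⟩
  let e := I.equivFin
  obtain ⟨p, hp, hsum, -, -⟩ := exists_continuous_sum_one_of_isOpen_isCompact
    (s := fun i => U (e.symm i).1) (fun i => hU _ (e.symm i).1.2) f.hasCompactSupport.isCompact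
    (fun y hy => by
      obtain ⟨z, hz, hyz⟩ := mem_iUnion₂.1 (hI hy)
      refine mem_iUnion.2 ⟨e ⟨z, hz⟩, ?_⟩
      rwa [e.symm_apply_apply])
  -- The partition of unity, made complex-valued so that it acts on `C_c(Y, ℂ)`; each `q i • f` is
  -- supported in one of the given open sets.
  let q : Fin I.card → C(Y, ℂ) := fun i =>
    ⟨fun y => (p i y : ℂ), Complex.continuous_ofReal.comp (map_continuous (p i))⟩
  have hf : f = ∑ i, q i • f := by
    ext y
    rw [CompactlySupportedContinuousMap.sum_apply]
    simp only [CompactlySupportedContinuousMap.smulc_apply, smul_eq_mul]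
    rw [← Finset.sum_mul]
    by_cases hy : f y = 0
    · simp [hy]
    have h1 := hsum (subset_tsupport _ hy)
    simp only [Finset.sum_apply, Pi.one_apply] at h1
    have h2 : ∑ i, q i y = 1 := by
      change ∑ i, ((p i y : ℝ) : ℂ) = 1
      rw [← Complex.ofReal_sum, h1, Complex.ofReal_one]
    rw [h2, one_mul]
  rw [hf, map_sum]
  refine Finset.sum_eq_zero fun i _ => hL _ (e.symm i).1.2 _ (Subset.trans ?_ (hp i))
  refine closure_mono fun y hy => ?_
  have hy' : (p i y : ℂ) * f y ≠ 0 := hy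
  exact Complex.ofReal_ne_zero.1 (left_ne_zero_of_mul hy')

/-- A linear functional on `C_c(Y)` invariant under multiplication by `k` is supported on
`k = 1`. -/
theorem CompactlySupportedContinuousMap.apply_eq_zero_of_smul_invariant {Y : Type*}
    [TopologicalSpace Y] (L : C_c(Y, ℂ) →ₗ[ℂ] ℂ) (k : C(Y, ℂ))
    (hk : ∀ f : C_c(Y, ℂ), L (k • f) = L f) (f : C_c(Y, ℂ)) (h : ∀ y ∈ tsupport f, k y ≠ 1) :
    L f = 0 := by
  -- Dividing by `k - 1` writes `f` as `k g - g`. Zeros of `k - 1` lie outside `tsupport f`, where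
  -- the factor `f` makes the product zero, so continuity need only be checked on the support.
  let g : C_c(Y, ℂ) := ⟨⟨fun y => (k y - 1)⁻¹ * f y, by
    refine continuous_of_tsupport fun y hy => ?_
    have hy' : y ∈ tsupport f := closure_mono (Function.support_mul_subset_right _ _) hy
    have hk1 : ContinuousAt (fun y => k y - 1) y := by fun_prop
    exact (hk1.inv₀ (sub_ne_zero.2 (h y hy'))).mul (map_continuous f).continuousAt⟩,
    f.hasCompactSupport.mul_left⟩
  have hf : f = k • g - g := by
    ext y
    change f y = k y * ((k y - 1)⁻¹ * f y) - (k y - 1)⁻¹ * f y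
    by_cases hy : f y = 0
    · simp [hy]
    have := sub_ne_zero.2 (h y (subset_tsupport _ hy))
    field_simp
  rw [hf, map_sub, hk, sub_self]

/-! ### The support of a KMS state. -/

namespace DRGroupoid

variable {X : Type u} {T : X → X} [TopologicalSpace X] [T2Space X]

theorem conv_unit (hT : IsLocalHomeomorph T) (f g : C_c(DRGroupoid T, ℂ)) (x : X) :
    conv hT f g (unit T x) = ∑ᶠ a : {a : DRGroupoid T // a.r = x}, f a.1 * g a.1.inv := by
  change ∑ᶠ a : {a : DRGroupoid T // a.r = x}, f a * g (a.1.ldiv (unit T x) a.2) = _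
  refine finsum_congr fun a => ?_
  congr 2
  exact ext' rfl (by simp [ldiv]) a.2.symm

variable [CompactSpace X]

/-- The element of `C_c(G)` supported on the unit space defined by `h ∈ C(X)`. -/
def ofUnits (T : X → X) (h : C(X, ℂ)) : C_c(DRGroupoid T, ℂ) :=
  ⟨⟨(range (unit T)).indicator fun γ => h γ.r,
    isClopen_range_unit.continuous_indicator ((map_continuous h).comp continuous_r)⟩,
    HasCompactSupport.intro isCompact_range_unit fun _ hγ =>
      indicator_of_notMem hγ fun γ : DRGroupoid T => h γ.r⟩

theorem ofUnits_unit (h : C(X, ℂ)) (x : X) : ofUnits T h (unit T x) = h x :=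
  indicator_of_mem (mem_range_self x) fun γ : DRGroupoid T => h γ.r

theorem ofUnits_of_notMem (h : C(X, ℂ)) {γ : DRGroupoid T} (hγ : γ ∉ range (unit T)) :
    ofUnits T h γ = 0 :=
  indicator_of_notMem hγ fun γ : DRGroupoid T => h γ.r

theorem conv_ofUnits_left (hT : IsLocalHomeomorph T) (h : C(X, ℂ)) (f : C_c(DRGroupoid T, ℂ))
    (γ : DRGroupoid T) : conv hT (ofUnits T h) f γ = h γ.r * f γ := by
  change ∑ᶠ a : {a : DRGroupoid T // a.r = γ.r}, ofUnits T h a * f (a.1.ldiv γ a.2) = _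
  rw [finsum_eq_single _ ⟨unit T γ.r, rfl⟩]
  · rw [ofUnits_unit]
    congr 2
    exact ext' rfl (by simp [ldiv]) rfl
  · rintro ⟨a, ha⟩ hne
    rw [ofUnits_of_notMem, zero_mul]
    rintro ⟨x, rfl⟩
    exact hne (Subtype.ext (congrArg (unit T) ha))

theorem conv_ofUnits_right (hT : IsLocalHomeomorph T) (h : C(X, ℂ)) (f : C_c(DRGroupoid T, ℂ))
    (γ : DRGroupoid T) : conv hT f (ofUnits T h) γ = f γ * h γ.s := by
  change ∑ᶠ a : {a : DRGroupoid T // a.r = γ.r}, f a * ofUnits T h (a.1.ldiv γ a.2) = _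
  rw [finsum_eq_single _ ⟨γ, rfl⟩]
  · have : γ.ldiv γ rfl = unit T γ.s := ext' rfl (by simp [ldiv]) rfl
    rw [this, ofUnits_unit]
  · rintro ⟨a, ha⟩ hne
    rw [ofUnits_of_notMem, mul_zero]
    -- If `a⁻¹γ` is a unit then `a = γ`, so only one term of the convolution survives.
    rintro ⟨x, hx⟩
    refine hne (Subtype.ext (ext' ha ?_ ?_))
    · have := congrArg deg hx
      simp only [ldiv, deg_unit, deg_comp, deg_inv] at this
      simp only
      omega
    · exact (congrArg r hx).symm.trans (congrArg s hx)

variable {hT : IsLocalHomeomorph T} {φ : C(X, ℝ)} {β : ℝ} {ω : CStar hT →L[ℂ] ℂ}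

/-- This is the KMS condition with `b` the unit `ofUnits T 1`. -/
theorem IsKMS.apply_expCocycle_smul (h : IsKMS (action hT φ) β ω) (f : C_c(DRGroupoid T, ℂ)) :
    ω (toCStar hT (expCocycle hT φ (Complex.I * β) • f)) = ω (toCStar hT f) := by
  have := h.apply_conv f (ofUnits T 1)
  have h1 : conv hT (ofUnits T 1) (expCocycle hT φ (Complex.I * β) • f) =
      expCocycle hT φ (Complex.I * β) • f := by
    ext γ
    rw [conv_ofUnits_left, ContinuousMap.one_apply, one_mul]
  have h2 : conv hT f (ofUnits T 1) = f := by
    ext γ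
    rw [conv_ofUnits_right, ContinuousMap.one_apply, mul_one]
  rwa [h1, h2] at this

/-- `C(X)` lies in the centralizer of a KMS state. -/
theorem IsKMS.apply_conv_ofUnits (h : IsKMS (action hT φ) β ω) (f : C_c(DRGroupoid T, ℂ))
    (k : C(X, ℂ)) :
    ω (toCStar hT (conv hT f (ofUnits T k))) = ω (toCStar hT (conv hT (ofUnits T k) f)) := by
  rw [← h.apply_conv (ofUnits T k) f]
  -- The cocycle vanishes on units, so `e^{-βc_φ}` does not change `ofUnits T k`.
  congr 3
  ext γ
  rw [CompactlySupportedContinuousMap.smulc_apply]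
  by_cases hγ : γ ∈ range (unit T)
  · obtain ⟨x, rfl⟩ := hγ
    simp [expCocycle_apply, cocycle_unit]
  · rw [ofUnits_of_notMem _ hγ, smul_zero]

/-- The functional on `C_c(G)` defined by a functional on `C*(G)`. -/
def restrictCore (ω : CStar hT →L[ℂ] ℂ) : C_c(DRGroupoid T, ℂ) →ₗ[ℂ] ℂ :=
  ω.toLinearMap ∘ₗ toCStar hT

/-- A KMS state is supported on the zero set of the cocycle. -/
theorem IsKMS.exists_isOpen_of_cocycle_ne_zero (h : IsKMS (action hT φ) β ω) {γ : DRGroupoid T}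
    (hγ : cocycle φ γ ≠ 0) : ∃ U, IsOpen U ∧ γ ∈ U ∧
      ∀ f : C_c(DRGroupoid T, ℂ), tsupport f ⊆ U → restrictCore ω f = 0 := by
  obtain ⟨k, hk, hk1⟩ : ∃ k : C(DRGroupoid T, ℂ),
      (∀ f : C_c(DRGroupoid T, ℂ), restrictCore ω (k • f) = restrictCore ω f) ∧ k γ ≠ 1 := by
    by_cases hβ : β = 0
    -- At `β = 0` the factor `e^{-βc_φ}` is trivial. Invariance under `α_t` is used instead, and `t
    -- = π / c_φ(γ)` makes `e^{itc_φ}` equal to `-1` at `γ`.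
    · refine ⟨expCocycle hT φ ((Real.pi / cocycle φ γ : ℝ) : ℂ), fun f => ?_, ?_⟩
      · exact h.invariant_of_zero hβ _ (toCStar hT f)
      · have : Complex.I * ((Real.pi / cocycle φ γ : ℝ) : ℂ) * cocycle φ γ =
            Real.pi * Complex.I := by
          have : (cocycle φ γ : ℂ) ≠ 0 := by exact_mod_cast hγ
          push_cast
          field_simp
        rw [expCocycle_apply, this, Complex.exp_pi_mul_I]
        norm_num
    · refine ⟨expCocycle hT φ (Complex.I * β), h.apply_expCocycle_smul, ?_⟩
      have : Complex.I * (Complex.I * β) * cocycle φ γ = ((-(β * cocycle φ γ) : ℝ) : ℂ) := by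
        rw [← mul_assoc, Complex.I_mul_I]; push_cast; ring
      rw [expCocycle_apply, this, ← Complex.ofReal_exp, Ne, Complex.ofReal_eq_one,
        Real.exp_eq_one_iff, neg_eq_zero]
      exact mul_ne_zero hβ hγ
  refine ⟨{a | k a ≠ 1}, isOpen_ne_fun (map_continuous k) continuous_const, hk1, fun f hf => ?_⟩
  exact CompactlySupportedContinuousMap.apply_eq_zero_of_smul_invariant _ k hk f fun a ha => hf ha

/-- A functional with `C(X)` in its centralizer is supported on the isotropy. -/
theorem IsKMS.exists_isOpen_of_r_ne_s (h : IsKMS (action hT φ) β ω) {γ : DRGroupoid T}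
    (hγ : γ.r ≠ γ.s) : ∃ U, IsOpen U ∧ γ ∈ U ∧
      ∀ f : C_c(DRGroupoid T, ℂ), tsupport f ⊆ U → restrictCore ω f = 0 := by
  obtain ⟨A, B, hA, hB, hrA, hsB, hAB⟩ := t2_separation hγ
  refine ⟨r ⁻¹' A ∩ s ⁻¹' B, (hA.preimage continuous_r).inter (hB.preimage continuous_s),
    ⟨hrA, hsB⟩, fun f hf => ?_⟩
  have hK := f.hasCompactSupport.isCompact
  -- A Urysohn function, `0` on the sources and `1` on the ranges of the support of `f`, gives `f *
  -- k = 0` and `k * f = f`; `ω` takes the same value at both.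
  obtain ⟨k, hk0, hk1, -⟩ := exists_continuous_zero_one_of_isClosed
    (hK.image continuous_s).isClosed (hK.image continuous_r).isClosed
    (hAB.symm.mono (image_subset_iff.2 fun a ha => (hf ha).2)
      (image_subset_iff.2 fun a ha => (hf ha).1))
  let k' : C(X, ℂ) := ⟨fun x => (k x : ℂ), Complex.continuous_ofReal.comp (map_continuous k)⟩
  have h1 : conv hT f (ofUnits T k') = 0 := by
    ext a
    rw [conv_ofUnits_right]
    by_cases ha : f a = 0
    · simp [ha]
    · have : k a.s = 0 := hk0 (mem_image_of_mem _ (subset_tsupport _ ha))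
      change f a * (k a.s : ℂ) = 0
      simp [this]
  have h2 : conv hT (ofUnits T k') f = f := by
    ext a
    rw [conv_ofUnits_left]
    by_cases ha : f a = 0
    · simp [ha]
    · have : k a.r = 1 := hk1 (mem_image_of_mem _ (subset_tsupport _ ha))
      change (k a.r : ℂ) * f a = f a
      simp [this]
  have h3 := h.apply_conv_ofUnits f k'
  rw [h1, h2, map_zero, map_zero] at h3
  exact h3.symm

/-- The restriction of `f ∈ C_c(G)` to the unit space. -/
def restrictUnits (f : C_c(DRGroupoid T, ℂ)) : C(X, ℂ) :=
  ⟨fun x => f (unit T x), (map_continuous f).comp continuous_unit⟩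

/-- If `c_φ⁻¹(0)` is principal, then a KMS state factors through the restriction to the unit
space. -/
theorem IsKMS.apply_eq_apply_ofUnits (h : IsKMS (action hT φ) β ω)
    (hφ : IsPrincipal {γ : DRGroupoid T | cocycle φ γ = 0}) (f : C_c(DRGroupoid T, ℂ)) :
    ω (toCStar hT f) = ω (toCStar hT (ofUnits T (restrictUnits f))) := by
  have := locallyCompactSpace hT
  rw [← sub_eq_zero, ← map_sub, ← map_sub]
  refine CompactlySupportedContinuousMap.apply_eq_zero_of_locally (restrictCore ω) _ fun γ hγ => ?_
  have hγ' : γ ∉ range (unit T) := by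
    have hcl : tsupport (f - ofUnits T (restrictUnits f)) ⊆ (range (unit T))ᶜ := by
      refine closure_minimal ?_ isOpen_range_unit.isClosed_compl
      rintro a ha ⟨x, rfl⟩
      refine ha ?_
      rw [CompactlySupportedContinuousMap.sub_apply, ofUnits_unit]
      exact sub_self _
    exact hcl hγ
  by_cases hc : cocycle φ γ = 0
  · refine h.exists_isOpen_of_r_ne_s fun hrs => hγ' ⟨γ.r, ?_⟩
    -- If `r(γ) = s(γ)`, then `γ` and the unit at `r(γ)` are two arrows of `c_φ⁻¹(0)` with the same
    -- endpoints, so principality identifies them.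
    exact hφ (cocycle_unit φ γ.r) hc (Prod.ext rfl hrs)
  · exact h.exists_isOpen_of_cocycle_ne_zero hc

end DRGroupoid

/-! ### States, and the measure on `X` defined by a state. -/

namespace DRGroupoid

section State

variable {A : Type*} [NonUnitalCStarAlgebra A] {ω : A →L[ℂ] ℂ}

/-- Polarization: the form is real on the diagonal, and the imaginary parts at `a + b` and `a + ib`
yield the two components of the identity. No unit is needed. -/
theorem IsState.conj_apply_star_mul (h : IsState ω) (a b : A) :
    (starRingEnd ℂ) (ω (star b * a)) = ω (star a * b) := by
  have him : ∀ a, (ω (star a * a)).im = 0 := fun a => ((Complex.le_def.1 (h.nonneg a)).2).symm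
  have h1 := him (a + b)
  have h2 := him (a + Complex.I • b)
  simp only [star_add, star_smul, mul_add, add_mul, map_add, smul_mul_assoc, mul_smul_comm,
    map_smul, smul_eq_mul, Complex.add_im, Complex.mul_im, Complex.mul_re, him,
    Complex.star_def, Complex.conj_I, Complex.neg_re, Complex.neg_im, Complex.I_re,
    Complex.I_im] at h1 h2
  apply Complex.ext
  · rw [Complex.conj_re]; linarith
  · rw [Complex.conj_im]; linarith

/-- The Cauchy–Schwarz inequality for states. -/
theorem IsState.norm_apply_star_mul_le (h : IsState ω) (a b : A) :
    ‖ω (star a * b)‖ * ‖ω (star b * a)‖ ≤ (ω (star a * a)).re * (ω (star b * b)).re := by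
  let c : PreInnerProductSpace.Core ℂ A :=
    { inner := fun a b => ω (star a * b)
      conj_inner_symm := fun a b => h.conj_apply_star_mul a b
      re_inner_nonneg := fun a => (Complex.le_def.1 (h.nonneg a)).1
      add_left := fun a b d => by
        change ω (star (a + b) * d) = ω (star a * d) + ω (star b * d)
        rw [star_add, add_mul, map_add]
      smul_left := fun a b z => by
        change ω (star (z • a) * b) = (starRingEnd ℂ) z * ω (star a * b)
        rw [star_smul, smul_mul_assoc, map_smul, smul_eq_mul]
        rfl }
  exact @InnerProductSpace.Core.inner_mul_inner_self_le ℂ A _ _ _ c a b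

theorem IsState.conj_apply (h : IsState ω) {e : A} (he : star e = e) (hl : ∀ a, e * a = a)
    (a : A) : (starRingEnd ℂ) (ω a) = ω (star a) := by
  have hr : star a * e = star a := by
    rw [← he, ← star_mul, hl]
  rw [← hr, ← h.conj_apply_star_mul, he, hl]

/-- A state takes the value `1` at the unit. -/
theorem IsState.apply_eq_one (h : IsState ω) {e : A} (he : star e = e) (hl : ∀ a, e * a = a) :
    ω e = 1 := by
  have hpos : 0 ≤ ω e := by
    have := h.nonneg e
    rwa [he, hl] at this
  have hre : (0 : ℝ) ≤ (ω e).re := (Complex.le_def.1 hpos).1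
  -- The `C*`-identity for the projection `e` gives `‖e‖ = ‖e‖²`.
  have hnorm : ‖e‖ ≤ 1 := by
    have h1 : ‖e‖ = ‖e‖ * ‖e‖ := by
      conv_lhs => rw [← hl e, ← he, he]
      nth_rw 1 [← he]
      exact CStarRing.norm_star_mul_self
    nlinarith [norm_nonneg e]
  have hle : (ω e).re ≤ 1 :=
    (Complex.re_le_norm _).trans ((ω.le_opNorm e).trans (by rw [h.norm_eq_one, one_mul]; exact hnorm))
  -- Cauchy–Schwarz against `e` gives `|ω(a)|² ≤ ω(e) ω(a*a) ≤ ω(e) ‖a‖²`. With `‖ω‖ = 1` this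
  -- forces `ω(e) ≥ 1`.
  have hge : ‖ω‖ ≤ Real.sqrt (ω e).re := by
    refine ω.opNorm_le_bound (Real.sqrt_nonneg _) fun a => ?_
    have h1 := h.norm_apply_star_mul_le e a
    have hr : star a * e = star a := by rw [← he, ← star_mul, hl]
    have h3 : (ω (star a * a)).re ≤ ‖a‖ * ‖a‖ := by
      refine (Complex.re_le_norm _).trans ((ω.le_opNorm _).trans ?_)
      rw [h.norm_eq_one, one_mul, CStarRing.norm_star_mul_self]
    rw [he, hl, hl, hr, ← h.conj_apply he hl, RCLike.norm_conj] at h1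
    refine abs_le_of_sq_le_sq' ?_ (by positivity) |>.2
    rw [mul_pow, Real.sq_sqrt hre]
    nlinarith
  rw [h.norm_eq_one, Real.one_le_sqrt] at hge
  exact Complex.ext (le_antisymm hle hge) (Complex.le_def.1 hpos).2.symm

end State

variable {X : Type u} {T : X → X} [TopologicalSpace X] [CompactSpace X] [T2Space X]

theorem ofUnits_add (h k : C(X, ℂ)) : ofUnits T (h + k) = ofUnits T h + ofUnits T k := by
  ext γ
  rw [CompactlySupportedContinuousMap.add_apply]
  by_cases hγ : γ ∈ range (unit T)
  · obtain ⟨x, rfl⟩ := hγ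
    simp only [ofUnits_unit, ContinuousMap.add_apply]
  · simp only [ofUnits_of_notMem _ hγ, add_zero]

theorem ofUnits_smul (c : ℂ) (h : C(X, ℂ)) : ofUnits T (c • h) = c • ofUnits T h := by
  ext γ
  rw [CompactlySupportedContinuousMap.smul_apply]
  by_cases hγ : γ ∈ range (unit T)
  · obtain ⟨x, rfl⟩ := hγ
    simp only [ofUnits_unit, ContinuousMap.smul_apply]
  · simp only [ofUnits_of_notMem _ hγ, smul_zero]

theorem adj_ofUnits (h : C(X, ℂ)) : adj (ofUnits T h) = ofUnits T (star h) := by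
  have hinv : ∀ x, (unit T x).inv = unit T x := fun x => ext' rfl (by simp) rfl
  ext γ
  change star (ofUnits T h γ.inv) = _
  by_cases hγ : γ ∈ range (unit T)
  · obtain ⟨x, rfl⟩ := hγ
    rw [hinv, ofUnits_unit, ofUnits_unit, ContinuousMap.star_apply]
  · rw [ofUnits_of_notMem _ hγ, ofUnits_of_notMem, star_zero]
    rintro ⟨x, hx⟩
    exact hγ ⟨x, by rw [← hinv, hx, inv_inv]⟩

theorem conv_ofUnits_ofUnits (hT : IsLocalHomeomorph T) (h k : C(X, ℂ)) :
    conv hT (ofUnits T h) (ofUnits T k) = ofUnits T (h * k) := by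
  ext γ
  rw [conv_ofUnits_left]
  by_cases hγ : γ ∈ range (unit T)
  · obtain ⟨x, rfl⟩ := hγ
    simp only [ofUnits_unit, ContinuousMap.mul_apply, r_unit]
  · simp only [ofUnits_of_notMem _ hγ, mul_zero]

/-- The characteristic function of the unit space is a unit of `C*(G)`. -/
theorem toCStar_ofUnits_one_mul (hT : IsLocalHomeomorph T) (a : CStar hT) :
    toCStar hT (ofUnits T 1) * a = a := by
  obtain ⟨a, ha⟩ := a
  refine Subtype.ext ?_
  change univRep hT (ofUnits T 1) * a = a
  -- The identity is a closed condition, so it is enough to check it on the dense image of `C_c(G)`.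
  have hcl : IsClosed {a : Ambient hT | univRep hT (ofUnits T 1) * a = a} :=
    isClosed_eq (by fun_prop) continuous_id
  refine closure_minimal ?_ hcl ha
  rintro _ ⟨f, rfl⟩
  change univRep hT (ofUnits T 1) * univRep hT f = univRep hT f
  rw [← univRep_conv]
  congr 1
  ext γ
  rw [conv_ofUnits_left, ContinuousMap.one_apply, one_mul]

theorem star_toCStar_ofUnits_one (hT : IsLocalHomeomorph T) :
    star (toCStar hT (ofUnits T 1)) = toCStar hT (ofUnits T 1) := by
  rw [← toCStar_adj, adj_ofUnits, star_one]

/-- The complexification of a continuous real function. -/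
def complexify (h : C(X, ℝ)) : C(X, ℂ) :=
  ⟨fun x => (h x : ℂ), Complex.continuous_ofReal.comp (map_continuous h)⟩

variable {hT : IsLocalHomeomorph T} {ω : CStar hT →L[ℂ] ℂ}

/-- A nonnegative function is `q* q` with `q` its square root, and `C(X)` embeds as a
`*`-subalgebra. -/
theorem IsState.apply_ofUnits_nonneg (h : IsState ω) {k : C(X, ℝ)} (hk : ∀ x, 0 ≤ k x) :
    0 ≤ ω (toCStar hT (ofUnits T (complexify k))) := by
  let q : C(X, ℝ) := ⟨fun x => Real.sqrt (k x), (map_continuous k).sqrt⟩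
  have hq : complexify k = star (complexify q) * complexify q := by
    ext x
    change (k x : ℂ) = star ((Real.sqrt (k x) : ℝ) : ℂ) * ((Real.sqrt (k x) : ℝ) : ℂ)
    rw [Complex.star_def, Complex.conj_ofReal, ← Complex.ofReal_mul, Real.mul_self_sqrt (hk x)]
  rw [hq, ← conv_ofUnits_ofUnits hT, toCStar_conv, ← adj_ofUnits, toCStar_adj]
  exact h.nonneg _

theorem IsState.apply_ofUnits_complexify (h : IsState ω) (k : C(X, ℝ)) :
    ω (toCStar hT (ofUnits T (complexify k))) =
      ((ω (toCStar hT (ofUnits T (complexify k)))).re : ℂ) := by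
  refine (Complex.conj_eq_iff_re.1 ?_).symm
  rw [h.conj_apply (star_toCStar_ofUnits_one hT) (toCStar_ofUnits_one_mul hT), ← toCStar_adj,
    adj_ofUnits]
  congr 3
  ext x
  exact Complex.conj_ofReal _

/-- The restriction of a state to `C(X)`, as a positive functional. -/
def IsState.positiveFunctional (h : IsState ω) : C_c(X, ℝ) →ₚ[ℝ] ℝ :=
  PositiveLinearMap.mk₀
    { toFun := fun k => (ω (toCStar hT (ofUnits T (complexify k.toContinuousMap)))).re
      map_add' := fun k l => by
        have : complexify (k + l).toContinuousMap =
            complexify k.toContinuousMap + complexify l.toContinuousMap := by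
          ext x; exact Complex.ofReal_add _ _
        rw [this, ofUnits_add, map_add, map_add, Complex.add_re]
      map_smul' := fun c k => by
        have : complexify (c • k).toContinuousMap =
            (c : ℂ) • complexify k.toContinuousMap := by
          ext x; exact Complex.ofReal_mul _ _
        rw [this, ofUnits_smul, map_smul, map_smul, smul_eq_mul, Complex.re_ofReal_mul]
        rfl }
    fun k hk => (Complex.le_def.1 (h.apply_ofUnits_nonneg fun x => hk x)).1

/-- The restriction of a state of `C*(G)` to `C(X)` is a probability measure. -/
theorem IsState.exists_measure [MeasurableSpace X] [BorelSpace X] (h : IsState ω) :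
    ∃ μ : Measure X, IsProbabilityMeasure μ ∧
      ∀ k : C(X, ℂ), ω (toCStar hT (ofUnits T k)) = ∫ x, k x ∂μ := by
  set μ := RealRMK.rieszMeasure h.positiveFunctional
  have hreal : ∀ k : C(X, ℝ), ω (toCStar hT (ofUnits T (complexify k))) = (∫ x, k x ∂μ : ℝ) := by
    intro k
    rw [h.apply_ofUnits_complexify k]
    exact congrArg Complex.ofReal (RealRMK.integral_rieszMeasure h.positiveFunctional
      (CompactlySupportedContinuousMap.continuousMapEquiv k)).symm
  -- The total mass is the value of `ω` at the unit.
  have hone : μ.real univ = 1 := by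
    have h1 := hreal 1
    have h2 : complexify (1 : C(X, ℝ)) = 1 := by ext x; exact Complex.ofReal_one
    rw [h2, h.apply_eq_one (star_toCStar_ofUnits_one hT) (toCStar_ofUnits_one_mul hT)] at h1
    have h3 : ∫ x, (1 : C(X, ℝ)) x ∂μ = 1 := by exact_mod_cast h1.symm
    simpa using h3
  have hμ : IsProbabilityMeasure μ := ⟨by
    rw [Measure.real] at hone
    exact (ENNReal.toReal_eq_one_iff _).1 hone⟩
  refine ⟨μ, hμ, fun k => ?_⟩
  have hint : Integrable (fun x => k x) μ :=
    (map_continuous k).integrable_of_hasCompactSupport (HasCompactSupport.of_compactSpace _)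
  let k₁ : C(X, ℝ) := ⟨fun x => (k x).re, Complex.continuous_re.comp (map_continuous k)⟩
  let k₂ : C(X, ℝ) := ⟨fun x => (k x).im, Complex.continuous_im.comp (map_continuous k)⟩
  have hk : k = complexify k₁ + Complex.I • complexify k₂ := by
    ext x
    change k x = ((k x).re : ℂ) + Complex.I * ((k x).im : ℂ)
    rw [mul_comm, Complex.re_add_im]
  have h1 := integral_re_add_im hint
  rw [← h1]
  conv_lhs => rw [hk]
  rw [ofUnits_add, ofUnits_smul, map_add, map_smul, map_add, map_smul, hreal, hreal, smul_eq_mul,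
    mul_comm]
  rfl

end DRGroupoid

/-! ### The measures `r^*μ` and `s^*μ`. -/

theorem Complex.ofReal_finsum {ι : Type*} (f : ι → ℝ) :
    ((∑ᶠ i, f i : ℝ) : ℂ) = ∑ᶠ i, (f i : ℂ) :=
  AddMonoidHom.map_finsum_of_injective (Complex.ofRealHom : ℝ →+ ℂ) Complex.ofReal_injective f

namespace DRGroupoid

variable {X : Type u} {T : X → X} [TopologicalSpace X]

/-- Shrink a basic set until `T^m` is injective on the ranges and `T^n` on the sources; then `T^m r
= T^n s` makes each endpoint determine the other. These open bisections yield local finiteness. -/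
theorem exists_isOpen_injOn_r_injOn_s (hT : IsLocalHomeomorph T) (γ : DRGroupoid T) :
    ∃ U : Set (DRGroupoid T), IsOpen U ∧ γ ∈ U ∧ InjOn r U ∧ InjOn s U := by
  obtain ⟨m, n, h1, h2⟩ := γ.exists_rep
  obtain ⟨A, hA, hγA, hA'⟩ := exists_injOn hT m γ.r
  obtain ⟨B, hB, hγB, hB'⟩ := exists_injOn hT n γ.s
  refine ⟨basicSet T A m n B, isOpen_basicSet hA hB m n, ⟨hγA, hγB, h1, h2⟩, ?_, ?_⟩
  · intro a ha b hb hab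
    refine ext' hab (ha.2.2.1.trans hb.2.2.1.symm) (hB' ha.2.1 hb.2.1 ?_)
    rw [← ha.2.2.2, ← hb.2.2.2, hab]
  · intro a ha b hb hab
    refine ext' (hA' ha.1 hb.1 ?_) (ha.2.2.1.trans hb.2.2.1.symm) hab
    rw [ha.2.2.2, hb.2.2.2, hab]

/-- A density gives one absolute continuity, and its strict positivity gives the other. -/
theorem HasModularFunction.isQuasiInvariant [MeasurableSpace X] {μ : Measure X}
    {D : DRGroupoid T → ℝ} (h : HasModularFunction T μ D)
    (hD : Continuous D) (hpos : ∀ γ, 0 < D γ) : IsQuasiInvariant T μ := by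
  rw [IsQuasiInvariant, h]
  refine ⟨withDensity_absolutelyContinuous _ _, withDensity_absolutelyContinuous'
    hD.measurable.ennreal_ofReal.aemeasurable (Eventually.of_forall fun γ => ?_)⟩
  exact (ENNReal.ofReal_pos.2 (hpos γ)).ne'

variable [T2Space X]

theorem lintegral_count_restrict (S : Set (DRGroupoid T)) (hS : MeasurableSet S)
    {f : DRGroupoid T → ℝ} (hf0 : ∀ γ, 0 ≤ f γ)
    (hfin : (Function.support fun γ : S => f γ).Finite) :
    ∫⁻ γ, ENNReal.ofReal (f γ) ∂(Measure.count.restrict S) =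
      ENNReal.ofReal (∑ᶠ γ : S, f γ) := by
  rw [← lintegral_indicator hS, lintegral_count,
    ← tsum_subtype S fun γ => ENNReal.ofReal (f γ), finsum_eq_sum _ hfin,
    ENNReal.ofReal_sum_of_nonneg (f := fun γ : S => f γ) fun γ _ => hf0 γ]
  refine tsum_eq_sum fun γ hγ => ?_
  have : f γ = 0 := by simpa using hγ
  rw [this, ENNReal.ofReal_zero]

theorem count_restrict_fiber_le_one [MeasurableSpace X] [BorelSpace X] {p : DRGroupoid T → X} (hp : Continuous p)
    {U : Set (DRGroupoid T)} (hU : InjOn p U) (x : X) :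
    (Measure.count : Measure (DRGroupoid T)).restrict (p ⁻¹' {x}) U ≤ 1 := by
  rw [Measure.restrict_apply' (hp.measurable (measurableSet_singleton x))]
  have hs : (U ∩ p ⁻¹' {x}).Subsingleton := fun a ha b hb =>
    hU ha.1 hb.1 (ha.2.trans hb.2.symm)
  rcases hs.eq_empty_or_singleton with h | ⟨a, h⟩
  · rw [h, measure_empty]; exact zero_le_one
  · rw [h, Measure.count_singleton]

section Measure

variable [MeasurableSpace X]

variable [BorelSpace X] [SecondCountableTopology X] {μ : Measure X}

theorem lintegral_rStar (hT : IsLocalHomeomorph T) {f : DRGroupoid T → ℝ} (hf : Continuous f)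
    (hf0 : ∀ γ, 0 ≤ f γ)
    (hfin : ∀ x, (Function.support fun γ : {γ : DRGroupoid T // γ.r = x} => f γ).Finite) :
    ∫⁻ γ, ENNReal.ofReal (f γ) ∂(rStar T μ) =
      ∫⁻ x, ENNReal.ofReal (∑ᶠ γ : {γ : DRGroupoid T // γ.r = x}, f γ) ∂μ := by
  rw [rStar, Measure.lintegral_bind (measurable_count_r hT).aemeasurable
    (hf.measurable.ennreal_ofReal.aemeasurable)]
  refine lintegral_congr fun x => ?_
  exact lintegral_count_restrict _ (continuous_r.measurable (measurableSet_singleton x)) hf0 (hfin x)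

theorem lintegral_sStar (hT : IsLocalHomeomorph T) {f : DRGroupoid T → ℝ} (hf : Continuous f)
    (hf0 : ∀ γ, 0 ≤ f γ)
    (hfin : ∀ x, (Function.support fun γ : {γ : DRGroupoid T // γ.s = x} => f γ).Finite) :
    ∫⁻ γ, ENNReal.ofReal (f γ) ∂(sStar T μ) =
      ∫⁻ x, ENNReal.ofReal (∑ᶠ γ : {γ : DRGroupoid T // γ.s = x}, f γ) ∂μ := by
  rw [sStar, Measure.lintegral_bind (measurable_count_s hT).aemeasurable
    (hf.measurable.ennreal_ofReal.aemeasurable)]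
  refine lintegral_congr fun x => ?_
  exact lintegral_count_restrict _ (continuous_s.measurable (measurableSet_singleton x)) hf0 (hfin x)

/-- An open bisection meets each fibre in at most one point, so its measure is at most `μ(X)`. -/
theorem isLocallyFiniteMeasure_rStar [IsFiniteMeasure μ] (hT : IsLocalHomeomorph T) :
    IsLocallyFiniteMeasure (rStar T μ) := by
  refine ⟨fun γ => ?_⟩
  obtain ⟨U, hU, hγ, hr, -⟩ := exists_isOpen_injOn_r_injOn_s hT γ
  refine ⟨U, hU.mem_nhds hγ, ?_⟩
  rw [rStar, Measure.bind_apply hU.measurableSet (measurable_count_r hT).aemeasurable]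
  refine (lintegral_mono fun x => count_restrict_fiber_le_one continuous_r hr x).trans_lt ?_
  rw [lintegral_one]
  exact measure_lt_top μ univ

theorem isLocallyFiniteMeasure_sStar [IsFiniteMeasure μ] (hT : IsLocalHomeomorph T) :
    IsLocallyFiniteMeasure (sStar T μ) := by
  refine ⟨fun γ => ?_⟩
  obtain ⟨U, hU, hγ, -, hs⟩ := exists_isOpen_injOn_r_injOn_s hT γ
  refine ⟨U, hU.mem_nhds hγ, ?_⟩
  rw [sStar, Measure.bind_apply hU.measurableSet (measurable_count_s hT).aemeasurable]
  refine (lintegral_mono fun x => count_restrict_fiber_le_one continuous_s hs x).trans_lt ?_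
  rw [lintegral_one]
  exact measure_lt_top μ univ

end Measure

/-! ### From the KMS condition to the modular function. -/

variable [CompactSpace X]

/-- Fibrewise sums of `f ∈ C_c(G)` are restrictions of convolution products to the unit space. -/
theorem exists_conv_unit_eq_finsum (hT : IsLocalHomeomorph T) (f : C_c(DRGroupoid T, ℂ)) :
    ∃ g : C_c(DRGroupoid T, ℂ),
      (∀ x, conv hT f g (unit T x) = ∑ᶠ a : {a : DRGroupoid T // a.r = x}, f a.1) ∧
      ∀ (k : C(DRGroupoid T, ℂ)) (x : X), conv hT g (k • f) (unit T x) =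
        ∑ᶠ a : {a : DRGroupoid T // a.s = x}, (k • f) a.1 := by
  have := locallyCompactSpace hT
  -- A compactly supported cutoff equal to `1` on the support of `f`. The witness is its adjoint,
  -- since convolution at a unit evaluates the second factor at `a⁻¹`.
  obtain ⟨b, hb, -, hbc, -⟩ := exists_continuous_one_zero_of_isCompact
    f.hasCompactSupport.isCompact isClosed_empty (disjoint_empty _)
  let b' : C_c(DRGroupoid T, ℂ) := ⟨⟨fun γ => (b γ : ℂ),
    Complex.continuous_ofReal.comp (map_continuous b)⟩, hbc.comp_left Complex.ofReal_zero⟩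
  have hb' : ∀ γ, f γ ≠ 0 → adj b' γ.inv = 1 := fun γ hγ => by
    change star ((b γ.inv.inv : ℝ) : ℂ) = 1
    rw [inv_inv, hb (subset_tsupport _ hγ)]
    simp
  refine ⟨adj b', fun x => ?_, fun k x => ?_⟩
  · rw [conv_unit]
    refine finsum_congr fun a => ?_
    by_cases ha : f a.1 = 0
    · simp [ha]
    · rw [hb' _ ha, mul_one]
  · rw [conv_unit]
    -- Inversion turns the sum over the `r`-fibre into one over the `s`-fibre.
    refine (finsum_eq_of_bijective
      (fun γ : {γ : DRGroupoid T // γ.s = x} => (⟨γ.1.inv, γ.2⟩ : {γ : DRGroupoid T // γ.r = x}))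
      ⟨fun a b h => ?_, fun b => ⟨⟨b.1.inv, b.2⟩, Subtype.ext (inv_inv b.1)⟩⟩ fun a => ?_).symm
    · have h' : a.1.inv = b.1.inv := congrArg Subtype.val h
      exact Subtype.ext (by rw [← inv_inv a.1, h', inv_inv])
    · simp only [inv_inv]
      by_cases ha : f a.1 = 0
      · simp [ha]
      · rw [hb' _ ha, one_mul]

variable [MeasurableSpace X] [BorelSpace X] [SecondCountableTopology X] {μ : Measure X}
  {hT : IsLocalHomeomorph T} {φ : C(X, ℝ)} {β : ℝ} {ω : CStar hT →L[ℂ] ℂ}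

/-- The KMS identity for `f` and the cutoff of `exists_conv_unit_eq_finsum`, integrated over `X`,
equates the two fibrewise sums. -/
theorem IsIntegrationState.lintegral_rStar_eq [IsFiniteMeasure μ]
    (hω : IsIntegrationState hT μ ω) (h : IsKMS (action hT φ) β ω) (f : C_c(DRGroupoid T, ℝ))
    (hf0 : ∀ γ, 0 ≤ f γ) :
    ∫⁻ γ, ENNReal.ofReal (f γ) ∂(rStar T μ) =
      ∫⁻ γ, ENNReal.ofReal (Real.exp (-β * cocycle φ γ) * f γ) ∂(sStar T μ) := by
  have hc := continuous_cocycle hT.continuous φ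
  obtain ⟨F, hF⟩ : ∃ F : C_c(DRGroupoid T, ℂ), ∀ γ, F γ = (f γ : ℂ) :=
    ⟨⟨⟨fun γ => (f γ : ℂ), Complex.continuous_ofReal.comp (map_continuous f)⟩,
      f.hasCompactSupport.comp_left Complex.ofReal_zero⟩, fun γ => rfl⟩
  have hkms := fun g => h.apply_conv F g
  have hk : ∀ γ, (expCocycle hT φ (Complex.I * β) • F) γ =
      ((Real.exp (-β * cocycle φ γ) * f γ : ℝ) : ℂ) := fun γ => by
    rw [CompactlySupportedContinuousMap.smulc_apply, expCocycle_apply, hF, smul_eq_mul,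
      ← mul_assoc Complex.I, Complex.I_mul_I]
    push_cast
    ring_nf
  generalize expCocycle hT φ (Complex.I * β) = k at hk hkms
  obtain ⟨g, hg1, hg2⟩ := exists_conv_unit_eq_finsum hT F
  replace hkms := hkms g
  have hr : ∀ x, conv hT F g (unit T x) =
      ((∑ᶠ γ : {γ : DRGroupoid T // γ.r = x}, f γ : ℝ) : ℂ) := fun x => by
    rw [hg1 x, Complex.ofReal_finsum]
    exact finsum_congr fun γ => hF γ.1
  have hs : ∀ x, conv hT g (k • F) (unit T x) =
      ((∑ᶠ γ : {γ : DRGroupoid T // γ.s = x}, Real.exp (-β * cocycle φ γ.1) * f γ.1 : ℝ) : ℂ) :=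
    fun x => by
      rw [hg2 k x, Complex.ofReal_finsum]
      exact finsum_congr fun γ => hk γ.1
  -- The fibre sums are restrictions of convolution products to units, hence continuous on the
  -- compact space `X` and integrable.
  have hint : ∀ (q : C_c(DRGroupoid T, ℂ)) (p : X → ℝ), (∀ x, q (unit T x) = (p x : ℂ)) →
      Integrable p μ := fun q p hqp => by
    have hp : Continuous p := by
      have : p = fun x => (q (unit T x)).re := by
        ext x; rw [hqp, Complex.ofReal_re]
      rw [this]
      exact Complex.continuous_re.comp ((map_continuous q).comp continuous_unit)
    exact hp.integrable_of_hasCompactSupport (HasCompactSupport.of_compactSpace _)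
  rw [hω, hω] at hkms
  simp only [hr] at hkms
  rw [integral_congr_ae (Eventually.of_forall hs), integral_complex_ofReal,
    integral_complex_ofReal,
    Complex.ofReal_inj] at hkms
  rw [lintegral_rStar hT (map_continuous f) hf0 fun x =>
      (hasFiniteSupport_r hT F x).subset fun γ hγ => by
        rw [Function.mem_support, hF]; exact Complex.ofReal_ne_zero.2 hγ,
    lintegral_sStar hT (by have := map_continuous f; fun_prop)
      (fun γ => mul_nonneg (Real.exp_pos _).le (hf0 γ)) fun x =>
      (hasFiniteSupport_s hT F x).subset fun γ hγ => by
        rw [Function.mem_support, hF]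
        exact Complex.ofReal_ne_zero.2 (right_ne_zero_of_mul hγ),
    ← ofReal_integral_eq_lintegral_ofReal (hint _ _ hr)
      (Eventually.of_forall fun x => finsum_nonneg fun γ => hf0 γ),
    ← ofReal_integral_eq_lintegral_ofReal (hint _ _ hs)
      (Eventually.of_forall fun x => finsum_nonneg fun γ =>
        mul_nonneg (Real.exp_pos _).le (hf0 γ)), hkms]

/-- The measure of an integration state satisfying the KMS condition has modular function
`e^{-βc_φ}`. -/
theorem IsIntegrationState.hasModularFunction [IsFiniteMeasure μ]
    (hω : IsIntegrationState hT μ ω) (h : IsKMS (action hT φ) β ω) :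
    HasModularFunction T μ fun γ => Real.exp (-β * cocycle φ γ) := by
  have hc := continuous_cocycle hT.continuous φ
  have hD : Continuous fun γ : DRGroupoid T => Real.exp (-β * cocycle φ γ) := by fun_prop
  -- These instances put both measures in the setting where integrals of compactly supported
  -- functions determine a measure.
  have := locallyCompactSpace hT
  have := secondCountableTopology (T := T)
  have := isLocallyFiniteMeasure_rStar (μ := μ) hT
  have := isLocallyFiniteMeasure_sStar (μ := μ) hT
  have := IsLocallyFiniteMeasure.withDensity_ofReal (μ := sStar T μ) hD
  have hpos : ∀ f : C_c(DRGroupoid T, ℝ), ∫⁻ γ, ENNReal.ofReal (f γ) ∂(rStar T μ) =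
      ∫⁻ γ, ENNReal.ofReal (f γ)
        ∂((sStar T μ).withDensity fun γ => ENNReal.ofReal (Real.exp (-β * cocycle φ γ))) := by
    intro f
    -- `ENNReal.ofReal` truncates at zero, so `f` may be replaced by its positive part. Applied to
    -- `-f`, the same equality handles the negative part below.
    let p : C_c(DRGroupoid T, ℝ) := ⟨⟨fun γ => max (f γ) 0, (map_continuous f).max continuous_const⟩,
      f.hasCompactSupport.comp_left (g := fun t : ℝ => max t 0) (max_self 0)⟩
    have hp : ∀ γ, ENNReal.ofReal (f γ) = ENNReal.ofReal (p γ) := fun γ => by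
      change _ = ENNReal.ofReal (max (f γ) 0)
      rw [ENNReal.ofReal_max, ENNReal.ofReal_zero, max_eq_left zero_le]
    simp only [hp]
    rw [hω.lintegral_rStar_eq h p fun γ => le_max_right _ _,
      lintegral_withDensity_eq_lintegral_mul _ hD.measurable.ennreal_ofReal
        (map_continuous p).measurable.ennreal_ofReal]
    exact lintegral_congr fun γ => ENNReal.ofReal_mul (Real.exp_pos _).le
  refine Measure.ext_of_integral_eq_on_compactlySupported fun f => ?_
  rw [integral_eq_lintegral_pos_part_sub_lintegral_neg_part
      ((map_continuous f).integrable_of_hasCompactSupport f.hasCompactSupport),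
    integral_eq_lintegral_pos_part_sub_lintegral_neg_part
      ((map_continuous f).integrable_of_hasCompactSupport f.hasCompactSupport), hpos f]
  congr 2
  exact hpos (-f)

end DRGroupoid

end

/-! ### The theorem on KMS states. -/

theorem corollary3p3 {X : Type*} [MetricSpace X] [CompactSpace X] [MeasurableSpace X]
    [BorelSpace X] (T : X → X) (hT : IsLocalHomeomorph T) (φ : C(X, ℝ))
    (hφ : DRGroupoid.IsPrincipal {γ : DRGroupoid T | DRGroupoid.cocycle φ γ = 0})
    (β : ℝ) (ω : DRGroupoid.CStar hT →L[ℂ] ℂ) (hω : DRGroupoid.IsState ω)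
    (hKMS : DRGroupoid.IsKMS (DRGroupoid.action hT φ) β ω) :
    ∃ μ : MeasureTheory.Measure X,
      MeasureTheory.IsProbabilityMeasure μ ∧
      DRGroupoid.IsQuasiInvariant T μ ∧
      DRGroupoid.HasModularFunction T μ (fun γ => Real.exp (-β * DRGroupoid.cocycle φ γ)) ∧
      DRGroupoid.IsIntegrationState hT μ ω := by
  obtain ⟨μ, hμ, hint⟩ := hω.exists_measure
  have hωμ : DRGroupoid.IsIntegrationState hT μ ω := fun f => by
    rw [hKMS.apply_eq_apply_ofUnits hφ, hint]
    rfl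
  have hmod := hωμ.hasModularFunction hKMS
  have hc := DRGroupoid.continuous_cocycle hT.continuous φ
  exact ⟨μ, hμ, hmod.isQuasiInvariant (by fun_prop) fun γ => Real.exp_pos _, hmod, hωμ⟩
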